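/- Conventions: $\hat f(\xi)=(2\pi)^{-1/2}\int_{\mathbb R}e^{-ix\xi}f(x)\,dx$ (extended to $L^2(\mathbb R)$ by Plancherel) and $\langle f_1,f_2\rangle=\int_{\mathbb R} f_1\overline{f_2}\,dx$. Let $\varphi\in L^2(\mathbb R)$ satisfy $\int_{\mathbb R} w(|\xi|)\,|\hat\varphi(\xi)|^2\,d\xi<\infty$ for some positive, monotonically increasing weight $w$ on $(0,\infty)$ with $w(\xi)\ge c\,\xi^{1+\epsilon}$ for all $\xi\ge1$ (where $c,\epsilon>0$). Let $\mathbf\Lambda\subseteq(0,\infty)$ be a non-empty set such that, for every $\lambda\in\mathbf\Lambda$, the family $\{\varphi(\cdot-n\lambda)\}_{n\in\mathbb Z}$ is a Riesz basis of its closed linear span in $L^2(\mathbb R)$. For $f\in L^2(\mathbb R)$ put $(P_\varphi f)(x)=\int_{\mathbb R} f(y)\,\overline{\varphi(y-x)}\,dy$, let $\mathcal P_\varphi=P_\varphi(L^2(\mathbb R))$ carry the inner product $$\langle g_1,g_2\rangle_\varphi=\frac1{2\pi}\int_{\{\hat\varphi\neq0\}}\hat g_1(\xi)\,\overline{\hat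 g_2(\xi)}\,|\hat\varphi(\xi)|^{-2}\,d\xi$$ and the norm $\|g\|_\varphi=\sqrt{\langle g,g\rangle_\varphi}$, and let $\Phi=P_\varphi\varphi$. For $\lambda\in\mathbf\Lambda$ let $\mathcal R_\lambda(\varphi)$ be the closed linear span of $\{\Phi(\cdot-n\lambda);\,n\in\mathbb Z\}$ in $\mathcal P_\varphi$. **Theorem.** Let $\lambda\in\mathbf\Lambda$ and $\Lambda=2\pi/\lambda$. There is a unique function $\Phi_{\mathrm{int}}\in\mathcal P_\varphi$ with $$\hat\Phi_{\mathrm{int}}(\xi)=\frac{\hat\Phi(\xi)}{\frac{\Lambda}{\sqrt{2\pi}}\sum_{n\in\mathbb Z}\hat\Phi(\xi+n\Lambda)}\quad\text{for a.e. }\xi\in\mathbb R,$$ where for a.e. $\xi$ the series in the denominator converges and the denominator is non-zero; moreover $\Phi_{\mathrm{int}}\in\mathcal R_\lambda(\varphi)$. Every $g\in\mathcal R_\lambda(\varphi)$ is perfectly reconstructed from its samples $g(n\lambda)$, $n\in\mathbb Z$, by $$g(x)=\sum_{n\in\mathbb Z}g(n\lambda)\,\Phi_{\mathrm{int}}(x-n\lambda),\qquad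 x\in\mathbb R,$$ and the series converges (unconditionally) in the norm of $\mathcal P_\varphi$ and uniformly on $\mathbb R$. -/

import Mathlib

open MeasureTheory Filter Topology
open scoped FourierTransform ComplexConjugate ENNReal

noncomputable section

namespace FreqLoc

/-- The translate `f(· - t)`. -/
def translate (t : ℝ) (f : ℝ → ℂ) : ℝ → ℂ := fun x => f (x - t)

theorem memLp_translate {f : ℝ → ℂ} (hf : MemLp f 2 volume) (t : ℝ) :
    MemLp (translate t f) 2 volume :=
  hf.comp_measurePreserving (measurePreserving_sub_right volume t)

/-- The translate `f(· - t)` of a square integrable function, as an element of `L²(ℝ)`. -/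
def translateL2 {f : ℝ → ℂ} (hf : MemLp f 2 volume) (t : ℝ) : Lp ℂ 2 (volume : Measure ℝ) :=
  (memLp_translate hf t).toLp (translate t f)

open Classical in
/-- The Fourier transform on `L²(ℝ)` in the angular frequency normalization
`f̂(ξ) = (2π)^(-1/2) ∫ e^(-ixξ) f(x) dx` (extended from integrable functions by Plancherel).
Mathlib's `𝓕` is normalized by `∫ e^(-2πixξ) f(x) dx`, whence the rescaling.
As for every element of `L²`, the value is meaningful up to null sets.
The value is `0` if `f` is not square integrable. -/
def fourierL2 (f : ℝ → ℂ) : ℝ → ℂ :=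
  if hf : MemLp f 2 volume then
    fun ξ => ((√(2 * Real.pi))⁻¹ : ℂ) *
      (𝓕 (hf.toLp f : Lp ℂ 2 (volume : Measure ℝ)) : Lp ℂ 2 (volume : Measure ℝ))
        (ξ / (2 * Real.pi))
  else 0

/-- A positive, monotonically increasing weight on `(0, ∞)` which grows at least like
`c ξ^(1+ε)` on `[1, ∞)`, for some `c, ε > 0`. -/
structure IsWeight (w : ℝ → ℝ) : Prop where
  pos : ∀ ξ, 0 < ξ → 0 < w ξ
  mono : MonotoneOn w (Set.Ioi 0)
  growth : ∃ c > 0, ∃ ε > 0, ∀ ξ, 1 ≤ ξ → c * ξ ^ (1 + ε) ≤ w ξ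

/-- The generalized moment `∫ w(|ξ|) |φ̂(ξ)|² dξ` is finite. -/
def HasFiniteMoment (w : ℝ → ℝ) (φ : ℝ → ℂ) : Prop :=
  Integrable (fun ξ : ℝ => w |ξ| * ‖fourierL2 φ ξ‖ ^ 2) volume

/-- `v` is a Riesz basis of its closed linear span. -/
def IsRieszSequence {ι H : Type*} [NormedAddCommGroup H] [NormedSpace ℂ H] (v : ι → H) : Prop :=
  ∃ A > (0 : ℝ), ∃ B > (0 : ℝ), ∀ (s : Finset ι) (c : ι → ℂ),
    A * ∑ n ∈ s, ‖c n‖ ^ 2 ≤ ‖∑ n ∈ s, c n • v n‖ ^ 2 ∧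
    ‖∑ n ∈ s, c n • v n‖ ^ 2 ≤ B * ∑ n ∈ s, ‖c n‖ ^ 2

/-- The frequency localization operator (prefilter)
`(P_φ f)(x) = ∫ f(y) conj(φ(y - x)) dy = ⟨f, φ(· - x)⟩`. -/
def prefilter (φ f : ℝ → ℂ) : ℝ → ℂ := fun x => ∫ y : ℝ, f y * conj (φ (y - x))

/-- The localization space `𝒫_φ`: the range of `P_φ` on `L²(ℝ)`. -/
def localizationSpace (φ : ℝ → ℂ) : Set (ℝ → ℂ) :=
  {g | ∃ f : ℝ → ℂ, MemLp f 2 volume ∧ g = prefilter φ f}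

/-- The autocorrelation function `Φ = P_φ φ`. -/
def autocorr (φ : ℝ → ℂ) : ℝ → ℂ := prefilter φ φ

/-- The inner product of `𝒫_φ`:
`⟨g₁, g₂⟩_φ = (1/2π) ∫_{φ̂ ≠ 0} ĝ₁(ξ) conj(ĝ₂(ξ)) |φ̂(ξ)|⁻² dξ`. -/
def innerP (φ g₁ g₂ : ℝ → ℂ) : ℂ :=
  ((2 * Real.pi : ℝ) : ℂ)⁻¹ * ∫ ξ in Function.support (fourierL2 φ),
    fourierL2 g₁ ξ * conj (fourierL2 g₂ ξ) * ((‖fourierL2 φ ξ‖ ^ 2 : ℝ) : ℂ)⁻¹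

/-- The norm `‖g‖_φ = √⟨g, g⟩_φ` of `𝒫_φ`. -/
def normP (φ g : ℝ → ℂ) : ℝ := √(innerP φ g g).re

/-- The reconstruction subspace `ℛ_λ(φ)`: the closure in `𝒫_φ` (for `‖·‖_φ`) of the linear span
of the translates `Φ(· - nλ)`, `n ∈ ℤ`. -/
def reconstructionSpace (φ : ℝ → ℂ) (lam : ℝ) : Set (ℝ → ℂ) :=
  {g | g ∈ localizationSpace φ ∧ ∀ ε > (0 : ℝ),
    ∃ v ∈ Submodule.span ℂ (Set.range fun n : ℤ => translate (n * lam) (autocorr φ)),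
      normP φ (g - v) < ε}

/-- The denominator `(Λ/√(2π)) ∑ₙ Φ̂(ξ + nΛ)` with `Λ = 2π/λ`. -/
def intDenominator (φ : ℝ → ℂ) (lam ξ : ℝ) : ℂ :=
  ((2 * Real.pi / lam / √(2 * Real.pi) : ℝ) : ℂ) *
    ∑' n : ℤ, fourierL2 (autocorr φ) (ξ + n * (2 * Real.pi / lam))

/-- `Φint` is square integrable and has the Fourier transform
`Φ̂(ξ) / ((Λ/√(2π)) ∑ₙ Φ̂(ξ + nΛ))`; for almost every `ξ` the series in the denominator converges
and the denominator does not vanish. -/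
def HasInterpolatingTransform (φ : ℝ → ℂ) (lam : ℝ) (Φint : ℝ → ℂ) : Prop :=
  MemLp Φint 2 volume ∧ ∀ᵐ ξ : ℝ,
    Summable (fun n : ℤ => fourierL2 (autocorr φ) (ξ + n * (2 * Real.pi / lam))) ∧
    intDenominator φ lam ξ ≠ 0 ∧
    fourierL2 Φint ξ = fourierL2 (autocorr φ) ξ / intDenominator φ lam ξ

end FreqLoc

end

noncomputable section

namespace FreqLoc

section RieszSequence

variable {ι H : Type*} [NormedAddCommGroup H] [InnerProductSpace ℂ H]

/-- The Bessel inequality, dual to an upper bound for the synthesis operator. -/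
theorem sum_norm_inner_sq_le {v : ι → H} {B : ℝ} (hB : 0 ≤ B)
    (hv : ∀ (s : Finset ι) (c : ι → ℂ), ‖∑ n ∈ s, c n • v n‖ ^ 2 ≤ B * ∑ n ∈ s, ‖c n‖ ^ 2)
    (f : H) (s : Finset ι) : ∑ n ∈ s, ‖inner ℂ (v n) f‖ ^ 2 ≤ B * ‖f‖ ^ 2 := by
  set S := ∑ n ∈ s, ‖inner ℂ (v n) f‖ ^ 2 with hS
  set u := ∑ n ∈ s, (inner ℂ (v n) f : ℂ) • v n with hu
  have h0 : 0 ≤ S := Finset.sum_nonneg fun _ _ => by positivity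
  have h1 : (inner ℂ u f : ℂ) = (S : ℂ) := by
    rw [hu, sum_inner, hS]
    push_cast
    refine Finset.sum_congr rfl fun n _ => ?_
    rw [inner_smul_left, Complex.conj_mul']
  have h2 : S ≤ ‖u‖ * ‖f‖ := by
    have := norm_inner_le_norm (𝕜 := ℂ) u f
    rwa [h1, Complex.norm_real, Real.norm_of_nonneg h0] at this
  have h3 : ‖u‖ ^ 2 ≤ B * S := hv s _
  rcases h0.eq_or_lt with h | h
  · rw [← h]; positivity
  · have : S * S ≤ (B * ‖f‖ ^ 2) * S := by
      calc S * S ≤ (‖u‖ * ‖f‖) * (‖u‖ * ‖f‖) := mul_self_le_mul_self h0 h2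
        _ = ‖u‖ ^ 2 * ‖f‖ ^ 2 := by ring
        _ ≤ B * S * ‖f‖ ^ 2 := by gcongr
        _ = _ := by ring
    exact le_of_mul_le_mul_right this h

/-- Expansion with respect to a pair of biorthogonal sequences whose synthesis operators are both
bounded. -/
theorem hasSum_inner_smul_of_biorthogonal {v w : ι → H} {B C : ℝ} (hB : 0 ≤ B) (hC : 0 ≤ C)
    (hv : ∀ (s : Finset ι) (c : ι → ℂ), ‖∑ n ∈ s, c n • v n‖ ^ 2 ≤ B * ∑ n ∈ s, ‖c n‖ ^ 2)
    (hw : ∀ (s : Finset ι) (c : ι → ℂ), ‖∑ n ∈ s, c n • w n‖ ^ 2 ≤ C * ∑ n ∈ s, ‖c n‖ ^ 2)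
    (hself : ∀ n, (inner ℂ (v n) (w n) : ℂ) = 1)
    (hne : ∀ m n, m ≠ n → (inner ℂ (v m) (w n) : ℂ) = 0) {f : H}
    (hf : f ∈ (Submodule.span ℂ (Set.range w)).topologicalClosure) :
    HasSum (fun n => (inner ℂ (v n) f : ℂ) • w n) f := by
  classical
  have hbd : ∀ (s : Finset ι) (g : H),
      ‖∑ n ∈ s, (inner ℂ (v n) g : ℂ) • w n‖ ≤ √(C * B) * ‖g‖ := by
    intro s g
    refine le_of_sq_le_sq ?_ (by positivity)
    rw [mul_pow, Real.sq_sqrt (by positivity), mul_assoc]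
    exact (hw s _).trans (mul_le_mul_of_nonneg_left (sum_norm_inner_sq_le hB hv g s) hC)
  rw [HasSum, SummationFilter.unconditional_filter, Metric.tendsto_atTop]
  intro ε hε
  have hK : 0 < √(C * B) + 1 := by positivity
  obtain ⟨u, hu, huf⟩ := Metric.mem_closure_iff.1 hf (ε / (√(C * B) + 1)) (by positivity)
  obtain ⟨d, rfl⟩ := (Finsupp.mem_span_range_iff_exists_finsupp).1 hu
  refine ⟨d.support, fun s hs => ?_⟩
  have hcoef : ∀ n, (inner ℂ (v n) (d.sum fun i a => a • w i) : ℂ) = d n := by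
    intro n
    rw [Finsupp.sum, inner_sum]
    simp only [inner_smul_right]
    rw [Finset.sum_eq_single n]
    · rw [hself, mul_one]
    · intro m _ hm
      rw [hne n m hm.symm, mul_zero]
    · intro hn
      rw [Finsupp.notMem_support_iff.1 hn, zero_mul]
  have hpart : ∑ n ∈ s, (inner ℂ (v n) (d.sum fun i a => a • w i) : ℂ) • w n
      = d.sum fun i a => a • w i := by
    simp only [hcoef]
    rw [Finsupp.sum]
    refine (Finset.sum_subset hs fun n _ hn => ?_).symm
    rw [Finsupp.notMem_support_iff.1 hn, zero_smul]
  set u := d.sum fun i a => a • w i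
  have hsplit : ∑ n ∈ s, (inner ℂ (v n) f : ℂ) • w n - f
      = ∑ n ∈ s, (inner ℂ (v n) (f - u) : ℂ) • w n - (f - u) := by
    simp only [inner_sub_right, sub_smul, Finset.sum_sub_distrib, hpart]
    abel
  rw [dist_eq_norm] at huf ⊢
  rw [hsplit]
  calc _ ≤ √(C * B) * ‖f - u‖ + ‖f - u‖ := (norm_sub_le _ _).trans (by gcongr; exact hbd s _)
    _ = (√(C * B) + 1) * ‖f - u‖ := by ring
    _ < (√(C * B) + 1) * (ε / (√(C * B) + 1)) := by gcongr
    _ = ε := by field_simp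

/-- The dual sequence of a Riesz sequence has a bounded synthesis operator. -/
theorem norm_sum_dual_sq_le {v w : ι → H} {A : ℝ} (hA : 0 < A)
    (hv : ∀ (s : Finset ι) (c : ι → ℂ), A * ∑ n ∈ s, ‖c n‖ ^ 2 ≤ ‖∑ n ∈ s, c n • v n‖ ^ 2)
    (hself : ∀ n, (inner ℂ (w n) (v n) : ℂ) = 1)
    (hne : ∀ m n, m ≠ n → (inner ℂ (w m) (v n) : ℂ) = 0)
    (hw : ∀ n, w n ∈ (Submodule.span ℂ (Set.range v)).topologicalClosure)
    (s : Finset ι) (c : ι → ℂ) :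
    ‖∑ n ∈ s, c n • w n‖ ^ 2 ≤ A⁻¹ * ∑ n ∈ s, ‖c n‖ ^ 2 := by
  classical
  set x := ∑ n ∈ s, c n • w n with hx
  set S := ∑ n ∈ s, ‖c n‖ ^ 2 with hS
  have hS0 : 0 ≤ S := Finset.sum_nonneg fun _ _ => by positivity
  have hxV : x ∈ (Submodule.span ℂ (Set.range v)).topologicalClosure :=
    Submodule.sum_mem _ fun n _ => Submodule.smul_mem _ _ (hw n)
  have key : ∀ u ∈ (Submodule.span ℂ (Set.range v)).topologicalClosure,
      ‖(inner ℂ x u : ℂ)‖ ^ 2 ≤ A⁻¹ * S * ‖u‖ ^ 2 := by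
    intro u hu
    have hcl : IsClosed {u : H | ‖(inner ℂ x u : ℂ)‖ ^ 2 ≤ A⁻¹ * S * ‖u‖ ^ 2} :=
      isClosed_le (by fun_prop) (by fun_prop)
    refine closure_minimal ?_ hcl hu
    intro u hu
    obtain ⟨d, rfl⟩ := (Finsupp.mem_span_range_iff_exists_finsupp).1 hu
    have hcoef : ∀ n, (inner ℂ (w n) (d.sum fun i a => a • v i) : ℂ) = d n := by
      intro n
      rw [Finsupp.sum, inner_sum]
      simp only [inner_smul_right]
      rw [Finset.sum_eq_single n]
      · rw [hself, mul_one]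
      · intro m _ hm
        rw [hne n m hm.symm, mul_zero]
      · intro hn
        rw [Finsupp.notMem_support_iff.1 hn, zero_mul]
    have h1 : (inner ℂ x (d.sum fun i a => a • v i) : ℂ) = ∑ n ∈ s, conj (c n) * d n := by
      rw [hx, sum_inner]
      simp only [inner_smul_left, hcoef]
    have h2 : ∑ n ∈ s, ‖d n‖ ^ 2 ≤ ∑ n ∈ d.support, ‖d n‖ ^ 2 := by
      rw [Finset.sum_subset (Finset.subset_union_right (s₁ := s) (s₂ := d.support))
        (f := fun n => ‖d n‖ ^ 2)]
      · exact Finset.sum_le_sum_of_subset_of_nonneg Finset.subset_union_left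
          fun _ _ _ => by positivity
      · intro n _ hn
        simp [Finsupp.notMem_support_iff.1 hn]
    have h3 : ∑ n ∈ d.support, ‖d n‖ ^ 2 ≤ A⁻¹ * ‖d.sum fun i a => a • v i‖ ^ 2 := by
      rw [le_inv_mul_iff₀ hA]
      exact hv d.support d
    simp only [Set.mem_ofPred_eq, h1]
    calc ‖∑ n ∈ s, conj (c n) * d n‖ ^ 2 ≤ (∑ n ∈ s, ‖c n‖ * ‖d n‖) ^ 2 := by
          gcongr
          refine (norm_sum_le _ _).trans_eq ?_
          simp
      _ ≤ S * ∑ n ∈ s, ‖d n‖ ^ 2 := Finset.sum_mul_sq_le_sq_mul_sq _ _ _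
      _ ≤ S * (A⁻¹ * ‖d.sum fun i a => a • v i‖ ^ 2) := by gcongr; exact h2.trans h3
      _ = _ := by ring
  have hxx := key x hxV
  rw [inner_self_eq_norm_sq_to_K] at hxx
  have h4 : ‖x‖ ^ 2 * ‖x‖ ^ 2 ≤ A⁻¹ * S * ‖x‖ ^ 2 := by
    simpa [sq] using hxx
  rcases (sq_nonneg ‖x‖).eq_or_lt with h | h
  · rw [← h]; positivity
  · exact le_of_mul_le_mul_right h4 h

/-- The expansion of an element of the closed span of a Riesz sequence in the dual sequence. -/
theorem IsRieszSequence.hasSum_dual [CompleteSpace H] {v w : ι → H} (hv : IsRieszSequence v)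
    (hself : ∀ n, (inner ℂ (v n) (w n) : ℂ) = 1)
    (hne : ∀ m n, m ≠ n → (inner ℂ (v m) (w n) : ℂ) = 0)
    (hw : ∀ n, w n ∈ (Submodule.span ℂ (Set.range v)).topologicalClosure)
    {f : H} (hf : f ∈ (Submodule.span ℂ (Set.range v)).topologicalClosure) :
    HasSum (fun n => (inner ℂ (v n) f : ℂ) • w n) f := by
  obtain ⟨A, hA, B, hB, hAB⟩ := hv
  have hself' : ∀ n, (inner ℂ (w n) (v n) : ℂ) = 1 := fun n => by
    rw [← inner_conj_symm, hself, map_one]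
  have hne' : ∀ m n, m ≠ n → (inner ℂ (w m) (v n) : ℂ) = 0 := fun m n h => by
    rw [← inner_conj_symm, hne n m h.symm, map_zero]
  have hA' : 0 ≤ A⁻¹ := by positivity
  have hsv := fun s c => (hAB s c).2
  have hsw := norm_sum_dual_sq_le hA (fun s c => (hAB s c).1) hself' hne' hw
  refine hasSum_inner_smul_of_biorthogonal hB.le hA' hsv hsw hself hne ?_
  set W := (Submodule.span ℂ (Set.range w)).topologicalClosure with hW
  have hWV : W ≤ (Submodule.span ℂ (Set.range v)).topologicalClosure :=
    Submodule.topologicalClosure_minimal _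
      (Submodule.span_le.2 (Set.range_subset_iff.2 hw))
      (Submodule.isClosed_topologicalClosure _)
  have : CompleteSpace W := (Submodule.isClosed_topologicalClosure _).completeSpace_coe
  set p : H := W.starProjection f
  have hp : p ∈ W := W.starProjection_apply_mem f
  have horth : ∀ n, (inner ℂ (w n) (f - p) : ℂ) = 0 := fun n =>
    (Submodule.mem_orthogonal _ _).1 (W.sub_starProjection_mem_orthogonal f) _
      (Submodule.le_topologicalClosure _ (Submodule.subset_span ⟨n, rfl⟩))
  have hsum := hasSum_inner_smul_of_biorthogonal hA' hB.le hsw hsv hself' hne'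
    (Submodule.sub_mem _ hf (hWV hp))
  simp only [horth, zero_smul] at hsum
  have h0 : f - p = 0 := hsum.unique hasSum_zero
  rw [sub_eq_zero.1 h0]
  exact hp

end RieszSequence

/-- The Hilbert space `L²(ℝ)`. -/
abbrev L2R : Type := Lp ℂ 2 (volume : Measure ℝ)

theorem integral_schwartz_mul_fourier (s : SchwartzMap ℝ ℂ) (f : L2R) :
    ∫ x, s x * (𝓕 f : L2R) x = ∫ x, 𝓕 (s : ℝ → ℂ) x * f x := by
  have h := congrArg (fun T : TemperedDistribution ℝ ℂ => T s)
    (Lp.fourier_toTemperedDistribution_eq f)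
  simp only [TemperedDistribution.fourier_apply, Lp.toTemperedDistribution_apply, smul_eq_mul,
    SchwartzMap.fourier_coe] at h
  exact h.symm

theorem integral_schwartz_mul_fourierInv (s : SchwartzMap ℝ ℂ) (f : L2R) :
    ∫ x, s x * (𝓕⁻ f : L2R) x = ∫ x, 𝓕⁻ (s : ℝ → ℂ) x * f x := by
  have h := congrArg (fun T : TemperedDistribution ℝ ℂ => T s)
    (Lp.fourierInv_toTemperedDistribution_eq f)
  simp only [TemperedDistribution.fourierInv_apply, Lp.toTemperedDistribution_apply, smul_eq_mul,
    SchwartzMap.fourierInv_coe] at h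
  exact h.symm

theorem L2R.locallyIntegrable (f : L2R) : LocallyIntegrable f :=
  (Lp.memLp f).locallyIntegrable (by norm_num)

/-- The `L²` inverse Fourier transform of an integrable function is given by the integral. -/
theorem fourierInv_toLp_ae_eq {G : ℝ → ℂ} (h1 : Integrable G) (h2 : MemLp G 2) :
    (𝓕⁻ (h2.toLp G : L2R) : L2R) =ᵐ[volume] (𝓕⁻ G : ℝ → ℂ) := by
  have hcont : Continuous (𝓕⁻ G : ℝ → ℂ) := by
    rw [Real.fourierInv_eq_fourier_comp_neg]
    exact VectorFourier.fourierIntegral_continuous Real.continuous_fourierChar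
      (by exact continuous_inner) h1.comp_neg
  refine ae_eq_of_integral_contDiff_smul_eq (L2R.locallyIntegrable _) hcont.locallyIntegrable ?_
  intro g hg hgc
  have hg' : ContDiff ℝ (⊤ : ℕ∞) (fun x => (g x : ℂ)) := Complex.ofRealCLM.contDiff.comp hg
  have hgc' : HasCompactSupport (fun x => (g x : ℂ)) := hgc.comp_left Complex.ofReal_zero
  have h := integral_schwartz_mul_fourierInv (hgc'.toSchwartzMap hg') (h2.toLp G)
  have hco : ((hgc'.toSchwartzMap hg' : SchwartzMap ℝ ℂ) : ℝ → ℂ) = fun x => (g x : ℂ) := rfl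
  rw [hco] at h
  simp only [Complex.real_smul]
  rw [h]
  have hgi : Integrable (fun x => (g x : ℂ)) := by
    rw [← hco]; exact SchwartzMap.integrable _
  have key := VectorFourier.integral_fourierIntegral_smul_eq_flip (L := -(innerₗ ℝ))
      (μ := volume) (ν := volume) (f := fun x => (g x : ℂ)) (g := G)
      Real.continuous_fourierChar (by simp; fun_prop) hgi h1
  have hflip : (-(innerₗ ℝ) : ℝ →ₗ[ℝ] ℝ →ₗ[ℝ] ℝ).flip = -(innerₗ ℝ) := by
    ext; simp
  rw [hflip] at key
  simp only [smul_eq_mul] at key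
  refine Eq.trans ?_ key
  refine integral_congr_ae ?_
  filter_upwards [h2.coeFn_toLp] with x hx
  rw [hx]
  rfl

theorem fourier_translateL2 {φ : ℝ → ℂ} (hφ : MemLp φ 2 volume) (t : ℝ) :
    (𝓕 (translateL2 hφ t : L2R) : L2R) =ᵐ[volume]
      fun η => Complex.exp (-(2 * Real.pi * t * η : ℝ) * Complex.I) *
        (𝓕 (hφ.toLp φ : L2R) : L2R) η := by
  have hloc : LocallyIntegrable (fun η : ℝ => Complex.exp (-(2 * Real.pi * t * η : ℝ) * Complex.I) *
        (𝓕 (hφ.toLp φ : L2R) : L2R) η) := by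
    have := (Lp.memLp (𝓕 (hφ.toLp φ : L2R) : L2R))
    refine MemLp.locallyIntegrable (p := 2) ?_ (by norm_num)
    refine this.of_le (.mul (by fun_prop) this.1) (ae_of_all _ fun η => ?_)
    rw [norm_mul, ← Complex.ofReal_neg, Complex.norm_exp_ofReal_mul_I, one_mul]
  refine ae_eq_of_integral_contDiff_smul_eq (L2R.locallyIntegrable _) hloc ?_
  intro g hg hgc
  have hg' : ContDiff ℝ (⊤ : ℕ∞) (fun x => (g x : ℂ)) := Complex.ofRealCLM.contDiff.comp hg
  have hgc' : HasCompactSupport (fun x => (g x : ℂ)) := hgc.comp_left Complex.ofReal_zero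
  have he : ContDiff ℝ (⊤ : ℕ∞)
      (fun η : ℝ => Complex.exp (-(2 * Real.pi * t * η : ℝ) * Complex.I) * (g η : ℂ)) := by
    refine ContDiff.mul (ContDiff.cexp (ContDiff.mul (ContDiff.neg ?_) contDiff_const)) hg'
    exact Complex.ofRealCLM.contDiff.comp (contDiff_const.mul contDiff_id)
  have hec : HasCompactSupport
      (fun η : ℝ => Complex.exp (-(2 * Real.pi * t * η : ℝ) * Complex.I) * (g η : ℂ)) :=
    hgc'.mul_left
  have h1 := integral_schwartz_mul_fourier (hgc'.toSchwartzMap hg') (translateL2 hφ t)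
  have h2 := integral_schwartz_mul_fourier (hec.toSchwartzMap he) (hφ.toLp φ)
  have hco1 : ((hgc'.toSchwartzMap hg' : SchwartzMap ℝ ℂ) : ℝ → ℂ) = fun x => (g x : ℂ) := rfl
  have hco2 : ((hec.toSchwartzMap he : SchwartzMap ℝ ℂ) : ℝ → ℂ) =
    fun η : ℝ => Complex.exp (-(2 * Real.pi * t * η : ℝ) * Complex.I) * (g η : ℂ) := rfl
  rw [hco1] at h1
  rw [hco2] at h2
  simp only [Complex.real_smul]
  rw [h1]
  have h3 : ∀ x, 𝓕 (fun η : ℝ => Complex.exp (-(2 * Real.pi * t * η : ℝ) * Complex.I) * (g η : ℂ)) x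
      = 𝓕 (fun x => (g x : ℂ)) (x + t) := by
    intro x
    rw [Real.fourier_real_eq_integral_exp_smul, Real.fourier_real_eq_integral_exp_smul]
    refine integral_congr_ae (ae_of_all _ fun η => ?_)
    simp only [smul_eq_mul]
    rw [← mul_assoc, ← Complex.exp_add]
    congr 2
    push_cast
    ring
  have h4 : ∫ x, 𝓕 (fun x => (g x : ℂ)) x * (translateL2 hφ t) x =
      ∫ x, 𝓕 (fun x => (g x : ℂ)) x * φ (x - t) := by
    refine integral_congr_ae ?_
    filter_upwards [(memLp_translate hφ t).coeFn_toLp] with x hx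
    rw [translateL2, hx]
    rfl
  rw [h4, ← integral_add_right_eq_self _ t]
  simp only [add_sub_cancel_right]
  have h5 : ∫ x, 𝓕 (fun x => (g x : ℂ)) (x + t) * φ x = ∫ x,
      𝓕 (fun η : ℝ => Complex.exp (-(2 * Real.pi * t * η : ℝ) * Complex.I) * (g η : ℂ)) x *
        (hφ.toLp φ : L2R) x := by
    refine integral_congr_ae ?_
    filter_upwards [hφ.coeFn_toLp] with x hx
    rw [hx, h3]
  rw [h5, ← h2]
  refine integral_congr_ae (ae_of_all _ fun η => ?_)
  simp only
  ring

theorem norm_translateL2 {φ : ℝ → ℂ} (hφ : MemLp φ 2 volume) (t : ℝ) :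
    ‖translateL2 hφ t‖ = ‖hφ.toLp φ‖ := by
  rw [translateL2, Lp.norm_toLp, Lp.norm_toLp]
  congr 1
  exact eLpNorm_comp_measurePreserving hφ.1 (measurePreserving_sub_right volume t)

theorem prefilter_eq_inner {φ f : ℝ → ℂ} (hφ : MemLp φ 2 volume) (hf : MemLp f 2 volume) (x : ℝ) :
    prefilter φ f x = inner ℂ (translateL2 hφ x) (hf.toLp f) := by
  rw [L2.inner_def, prefilter]
  refine integral_congr_ae ?_
  filter_upwards [(memLp_translate hφ x).coeFn_toLp, hf.coeFn_toLp] with y h1 h2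
  rw [translateL2, h1, h2]
  rfl

theorem norm_prefilter_le {φ f : ℝ → ℂ} (hφ : MemLp φ 2 volume) (hf : MemLp f 2 volume) (x : ℝ) :
    ‖prefilter φ f x‖ ≤ ‖hφ.toLp φ‖ * ‖hf.toLp f‖ := by
  rw [prefilter_eq_inner hφ hf, ← norm_translateL2 hφ x]
  exact norm_inner_le_norm _ _

theorem prefilter_congr_ae {φ f g : ℝ → ℂ} (h : f =ᵐ[volume] g) :
    prefilter φ f = prefilter φ g := by
  funext x
  refine integral_congr_ae ?_
  filter_upwards [h] with y hy
  rw [hy]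

theorem prefilter_eq_fourierInv {φ f : ℝ → ℂ} (hφ : MemLp φ 2 volume) (hf : MemLp f 2 volume) :
    prefilter φ f = 𝓕⁻ (fun η : ℝ => (𝓕 (hf.toLp f : L2R) : L2R) η *
      conj ((𝓕 (hφ.toLp φ : L2R) : L2R) η)) := by
  funext x
  rw [prefilter_eq_inner hφ hf, ← Lp.inner_fourier_eq, L2.inner_def, Real.fourierInv_eq']
  refine integral_congr_ae ?_
  filter_upwards [fourier_translateL2 hφ x] with η h
  rw [h]
  simp only [RCLike.inner_apply, map_mul, smul_eq_mul, ← Complex.exp_conj, Complex.conj_I, map_neg,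
    Complex.conj_ofReal]
  rw [mul_left_comm]
  congr 2
  simp only [conj_trivial]
  push_cast
  ring

theorem integrable_fourier_mul_conj (f φ : L2R) :
    Integrable (fun η : ℝ => (𝓕 f : L2R) η * conj ((𝓕 φ : L2R) η)) := by
  have := L2.integrable_inner (𝕜 := ℂ) (𝓕 φ : L2R) (𝓕 f : L2R)
  simpa only [RCLike.inner_apply] using this

theorem continuous_prefilter {φ f : ℝ → ℂ} (hφ : MemLp φ 2 volume) (hf : MemLp f 2 volume) :
    Continuous (prefilter φ f) := by
  rw [prefilter_eq_fourierInv hφ hf, Real.fourierInv_eq_fourier_comp_neg]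
  exact VectorFourier.fourierIntegral_continuous Real.continuous_fourierChar
      (by exact continuous_inner) (integrable_fourier_mul_conj _ _).comp_neg

theorem memLp_mul_conj_of_bound {F a : ℝ → ℂ} (hF : MemLp F 2 volume)
    (ha : AEStronglyMeasurable a volume) {C : ℝ} (hb : ∀ᵐ η, ‖a η‖ ≤ C) :
    MemLp (fun η => F η * conj (a η)) 2 volume := by
  refine (hF.const_smul (C : ℂ)).of_le (hF.1.mul (by fun_prop)) ?_
  filter_upwards [hb] with η h
  have h0 : 0 ≤ C := (norm_nonneg _).trans h
  simp only [norm_mul, RCLike.norm_conj, Pi.smul_apply, smul_eq_mul, Complex.norm_real,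
    Real.norm_of_nonneg h0]
  rw [mul_comm]
  gcongr

theorem memLp_prefilter {φ f : ℝ → ℂ} (hφ : MemLp φ 2 volume) (hf : MemLp f 2 volume) {C : ℝ}
    (hb : ∀ᵐ η : ℝ, ‖(𝓕 (hφ.toLp φ : L2R) : L2R) η‖ ≤ C) : MemLp (prefilter φ f) 2 volume := by
  have h2 := memLp_mul_conj_of_bound (Lp.memLp (𝓕 (hf.toLp f : L2R) : L2R)) (Lp.memLp _).1 hb
  rw [prefilter_eq_fourierInv hφ hf]
  exact (memLp_congr_ae (fourierInv_toLp_ae_eq (integrable_fourier_mul_conj _ _) h2)).1 (Lp.memLp _)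

theorem fourier_prefilter {φ f : ℝ → ℂ} (hφ : MemLp φ 2 volume) (hf : MemLp f 2 volume) {C : ℝ}
    (hb : ∀ᵐ η : ℝ, ‖(𝓕 (hφ.toLp φ : L2R) : L2R) η‖ ≤ C) (h : MemLp (prefilter φ f) 2 volume) :
    (𝓕 (h.toLp _ : L2R) : L2R) =ᵐ[volume] fun η : ℝ => (𝓕 (hf.toLp f : L2R) : L2R) η *
      conj ((𝓕 (hφ.toLp φ : L2R) : L2R) η) := by
  have h2 := memLp_mul_conj_of_bound (Lp.memLp (𝓕 (hf.toLp f : L2R) : L2R)) (Lp.memLp _).1 hb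
  have heq : (h.toLp _ : L2R) = 𝓕⁻ (h2.toLp _ : L2R) := by
    refine Lp.ext (h.coeFn_toLp.trans ?_)
    rw [prefilter_eq_fourierInv hφ hf]
    exact (fourierInv_toLp_ae_eq (integrable_fourier_mul_conj _ _) h2).symm
  rw [heq, FourierTransform.fourier_fourierInv_eq]
  exact h2.coeFn_toLp

section Periodization

open Set AddCircle

variable {T : ℝ}

theorem periodic_tsum_add_zsmul (T : ℝ) (g : ℝ → ℝ≥0∞) :
    Function.Periodic (fun η => ∑' n : ℤ, g (η + n * T)) T := by
  intro η
  change ∑' n : ℤ, g (η + T + n * T) = ∑' n : ℤ, g (η + n * T)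
  rw [← (Equiv.addRight (1 : ℤ)).tsum_eq fun n : ℤ => g (η + n * T)]
  refine tsum_congr fun n => ?_
  simp only [Equiv.coe_addRight]
  congr 1
  push_cast
  ring

/-- The periodization `∑ₙ g(· + nT)` as a function on the circle of length `T`. -/
def periodization (T : ℝ) (g : ℝ → ℝ≥0∞) : AddCircle T → ℝ≥0∞ :=
  (periodic_tsum_add_zsmul T g).lift

@[simp]
theorem periodization_coe (g : ℝ → ℝ≥0∞) (η : ℝ) :
    periodization T g (η : AddCircle T) = ∑' n : ℤ, g (η + n * T) :=
  (periodic_tsum_add_zsmul T g).lift_coe η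

theorem measurable_periodization {g : ℝ → ℝ≥0∞} (hg : Measurable g) :
    Measurable (periodization T g) := by
  refine QuotientAddGroup.measurable_from_quotient.2 ?_
  have : periodization T g ∘ ((↑) : ℝ → AddCircle T) = fun η => ∑' n : ℤ, g (η + n * T) := by
    funext η
    exact periodization_coe g η
  exact this ▸ Measurable.tsum fun n => by fun_prop

variable [hT : Fact (0 < T)]

theorem lintegral_coe_mul {g : ℝ → ℝ≥0∞} (hg : Measurable g) {F : AddCircle T → ℝ≥0∞}
    (hF : Measurable F) :
    ∫⁻ η : ℝ, F η * g η = ∫⁻ q, F q * periodization T g q := by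
  have hF' : Measurable fun η : ℝ => F (η : AddCircle T) := hF.comp AddCircle.measurable_mk'
  have h1 : ∫⁻ η : ℝ, F η * g η
      = ∑' n : ℤ, ∫⁻ η in Ioc (n • T) ((n + 1) • T), F (η : AddCircle T) * g η := by
    rw [← lintegral_iUnion (fun _ => measurableSet_Ioc) (pairwise_disjoint_Ioc_zsmul T),
      iUnion_Ioc_zsmul hT.out, Measure.restrict_univ]
  have h2 : ∀ n : ℤ, ∫⁻ η in Ioc (n • T) ((n + 1) • T), F (η : AddCircle T) * g η
      = ∫⁻ η in Ioc 0 (0 + T), F (η : AddCircle T) * g (η + n * T) := by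
    intro n
    have hpre : (fun η : ℝ => η + n * T) ⁻¹' Ioc (n • T) ((n + 1) • T) = Ioc 0 (0 + T) := by
      ext η
      simp only [mem_preimage, mem_Ioc, zsmul_eq_mul, Int.cast_add, Int.cast_one]
      constructor <;> rintro ⟨h, h'⟩ <;> constructor <;> linarith
    have hmp := measurePreserving_add_right (volume : Measure ℝ) (n * T)
    have hset := hmp.setLIntegral_comp_preimage (s := Ioc (n • T) ((n + 1) • T)) measurableSet_Ioc
      (f := fun η : ℝ => F (η : AddCircle T) * g η) (hF'.mul hg)
    rw [← hset, hpre]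
    refine lintegral_congr fun η => ?_
    congr 2
    rw [AddCircle.coe_add, ← zsmul_eq_mul, AddCircle.coe_zsmul, AddCircle.coe_period, smul_zero,
      add_zero]
  rw [h1, tsum_congr h2, ← lintegral_tsum fun n => by fun_prop, ← AddCircle.lintegral_preimage T 0]
  refine lintegral_congr fun η => ?_
  rw [ENNReal.tsum_mul_left, periodization_coe]

theorem map_withDensity_coe {g : ℝ → ℝ≥0∞} (hg : Measurable g) :
    ((volume : Measure ℝ).withDensity g).map ((↑) : ℝ → AddCircle T)
      = (haarAddCircle : Measure (AddCircle T)).withDensity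
          (fun q => ENNReal.ofReal T * periodization T g q) := by
  have hp := measurable_periodization (T := T) hg
  ext E hE
  have hpre : MeasurableSet (((↑) : ℝ → AddCircle T) ⁻¹' E) := AddCircle.measurable_mk' hE
  rw [Measure.map_apply AddCircle.measurable_mk' hE, withDensity_apply _ hpre,
    withDensity_apply _ hE, lintegral_const_mul _ hp, ← lintegral_indicator hpre,
    ← lintegral_indicator hE]
  have h := lintegral_coe_mul (T := T) hg (F := E.indicator 1) (measurable_one.indicator hE)
  rw [volume_eq_smul_haarAddCircle, lintegral_smul_measure, smul_eq_mul] at h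
  have e1 : ∀ η : ℝ, E.indicator 1 (η : AddCircle T) * g η
      = (((↑) : ℝ → AddCircle T) ⁻¹' E).indicator g η := by
    intro η
    by_cases hη : (η : AddCircle T) ∈ E
    · rw [indicator_of_mem hη, indicator_of_mem (by exact hη)]; simp
    · rw [indicator_of_notMem hη, indicator_of_notMem (by exact hη)]; simp
  have e2 : ∀ q, E.indicator 1 q * periodization T g q = E.indicator (periodization T g) q := by
    intro q
    by_cases hq : q ∈ E
    · rw [indicator_of_mem hq, indicator_of_mem hq]; simp
    · rw [indicator_of_notMem hq, indicator_of_notMem hq]; simp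
  simpa only [e1, e2] using h

/-- A property holding almost everywhere on the circle holds almost everywhere on the line. -/
theorem ae_coe_of_ae {P : AddCircle T → Prop}
    (h : ∀ᵐ q ∂(haarAddCircle : Measure (AddCircle T)), P q) :
    ∀ᵐ η : ℝ, P (η : AddCircle T) := by
  have h1 := map_withDensity_coe (T := T) (g := fun _ => 1) measurable_const
  have h2 : ∀ᵐ q ∂(((volume : Measure ℝ).withDensity fun _ => 1).map ((↑) : ℝ → AddCircle T)),
      P q := by
    rw [h1]
    exact (withDensity_absolutelyContinuous _ _).ae_le h
  have h3 := ae_of_ae_map (AddCircle.measurable_mk').aemeasurable h2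
  have h4 : ((volume : Measure ℝ).withDensity fun _ => 1) = volume := withDensity_one
  rwa [h4] at h3

/-- Trigonometric polynomials are dense in `L²` of any finite measure on the circle. -/
theorem exists_trigPoly_eLpNorm_sub_le (μ : Measure (AddCircle T)) [IsFiniteMeasure μ]
    {m : AddCircle T → ℂ} (hm : MemLp m 2 μ) {ε : ℝ≥0∞} (hε : ε ≠ 0) :
    ∃ p ∈ Submodule.span ℂ (range (@fourier T)), eLpNorm (m - ⇑p) 2 μ ≤ ε := by
  have hd := (ContinuousMap.toLp_denseRange (p := 2) ℂ μ ℂ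
    (by norm_num)).topologicalClosure_map_submodule (span_fourier_closure_eq_top (T := T))
  have hmem : hm.toLp m ∈ ((Submodule.span ℂ (range (@fourier T))).map
      (ContinuousMap.toLp (E := ℂ) 2 μ ℂ : C(AddCircle T, ℂ) →ₗ[ℂ] Lp ℂ 2 μ)).topologicalClosure := by
    rw [hd]; trivial
  rcases eq_or_ne ε ∞ with rfl | hε'
  · exact ⟨0, zero_mem _, le_top⟩
  obtain ⟨u, ⟨p, hp, rfl⟩, hu⟩ := Metric.mem_closure_iff.1 hmem ε.toReal
    (ENNReal.toReal_pos hε hε')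
  refine ⟨p, hp, ?_⟩
  have hpm := ContinuousMap.coeFn_toLp (p := 2) (𝕜 := ℂ) μ p
  rw [dist_eq_norm, Lp.norm_def, ENNReal.toReal_lt_toReal (Lp.eLpNorm_ne_top _) hε'] at hu
  refine le_trans (le_of_eq ?_) hu.le
  refine eLpNorm_congr_ae ?_
  refine EventuallyEq.trans ?_ (Lp.coeFn_sub _ _).symm
  exact (hm.coeFn_toLp.symm).sub hpm.symm

/-- Finite measures on the circle can be compared by testing trigonometric polynomials. -/
theorem measure_le_of_eLpNorm_trigPoly_le {μ₁ μ₂ : Measure (AddCircle T)} [IsFiniteMeasure μ₁]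
    [IsFiniteMeasure μ₂] {k : ℝ≥0∞} (hk : k ≠ ∞)
    (h : ∀ p ∈ Submodule.span ℂ (range (@fourier T)), eLpNorm (⇑p) 2 μ₁ ≤ k * eLpNorm (⇑p) 2 μ₂)
    {E : Set (AddCircle T)} (hE : MeasurableSet E) : μ₁ E ≤ k ^ 2 * μ₂ E := by
  set m : AddCircle T → ℂ := E.indicator fun _ => (1 : ℂ) with hmdef
  have hm : ∀ (μ : Measure (AddCircle T)) [IsFiniteMeasure μ], MemLp m 2 μ := fun μ _ =>
    memLp_indicator_const _ hE _ (Or.inr (measure_ne_top _ _))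
  have hn : ∀ μ : Measure (AddCircle T), eLpNorm m 2 μ = μ E ^ (1 / 2 : ℝ) := fun μ => by
    rw [hmdef, eLpNorm_indicator_const hE (by norm_num) (by norm_num)]
    simp
  have hineq : ∀ ε : ℝ≥0∞, ε ≠ 0 → eLpNorm m 2 μ₁ ≤ ε + k * (ε + eLpNorm m 2 μ₂) := by
    intro ε hε
    obtain ⟨p, hp, hpm⟩ := exists_trigPoly_eLpNorm_sub_le (μ₁ + μ₂) (hm _) hε
    have hp1 : eLpNorm (m - ⇑p) 2 μ₁ ≤ ε :=
      (eLpNorm_mono_measure _ (Measure.le_add_right le_rfl)).trans hpm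
    have hp2 : eLpNorm (m - ⇑p) 2 μ₂ ≤ ε :=
      (eLpNorm_mono_measure _ (Measure.le_add_left le_rfl)).trans hpm
    have hps : ∀ μ : Measure (AddCircle T), AEStronglyMeasurable (p : AddCircle T → ℂ) μ := fun μ =>
      p.continuous.aestronglyMeasurable
    calc eLpNorm m 2 μ₁ = eLpNorm ((m - ⇑p) + ⇑p) 2 μ₁ := by rw [sub_add_cancel]
      _ ≤ eLpNorm (m - ⇑p) 2 μ₁ + eLpNorm (⇑p) 2 μ₁ :=
        eLpNorm_add_le ((hm μ₁).1.sub (hps _)) (hps _) (by norm_num)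
      _ ≤ ε + k * eLpNorm (⇑p) 2 μ₂ := by gcongr; exact h p hp
      _ = ε + k * eLpNorm (m - (m - ⇑p)) 2 μ₂ := by rw [sub_sub_cancel]
      _ ≤ ε + k * (eLpNorm m 2 μ₂ + eLpNorm (m - ⇑p) 2 μ₂) := by
        gcongr
        exact eLpNorm_sub_le (hm μ₂).1 ((hm μ₂).1.sub (hps _)) (by norm_num)
      _ ≤ ε + k * (ε + eLpNorm m 2 μ₂) := by rw [add_comm (eLpNorm m 2 μ₂)]; gcongr
  have hlim : Tendsto (fun ε : ℝ≥0∞ => ε + k * (ε + eLpNorm m 2 μ₂)) (𝓝[≠] 0)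
      (𝓝 (0 + k * (0 + eLpNorm m 2 μ₂))) := by
    refine Tendsto.mono_left ?_ nhdsWithin_le_nhds
    exact tendsto_id.add (ENNReal.Tendsto.const_mul (tendsto_id.add tendsto_const_nhds)
      (Or.inr hk))
  have hfin : eLpNorm m 2 μ₁ ≤ 0 + k * (0 + eLpNorm m 2 μ₂) :=
    ge_of_tendsto hlim (eventually_nhdsWithin_of_forall fun ε hε => hineq ε hε)
  rw [zero_add, zero_add, hn, hn] at hfin
  have hsq := pow_le_pow_left₀ zero_le hfin 2
  rw [mul_pow] at hsq
  simpa only [← ENNReal.rpow_natCast, ← ENNReal.rpow_mul, Nat.cast_ofNat, one_div,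
    inv_mul_cancel₀ (two_ne_zero' ℝ), ENNReal.rpow_one] using hsq

/-- The norm of a periodic multiple of `a` is a weighted norm on the circle. -/
theorem eLpNorm_coe_mul {a : ℝ → ℂ} (ha : Measurable a) {m : AddCircle T → ℂ} (hm : Measurable m) :
    eLpNorm (fun η : ℝ => m η * a η) 2 volume
      = eLpNorm m 2 ((haarAddCircle : Measure (AddCircle T)).withDensity
          (fun q => ENNReal.ofReal T * periodization T (fun η => ‖a η‖ₑ ^ 2) q)) := by
  have hg : Measurable fun η => ‖a η‖ₑ ^ 2 := by fun_prop
  rw [← map_withDensity_coe hg, eLpNorm_map_measure hm.aestronglyMeasurable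
    AddCircle.measurable_mk'.aemeasurable]
  rw [eLpNorm_eq_lintegral_rpow_enorm_toReal (by norm_num) (by norm_num),
    eLpNorm_eq_lintegral_rpow_enorm_toReal (by norm_num) (by norm_num)]
  congr 1
  have hm' : Measurable fun η : ℝ => m (η : AddCircle T) := hm.comp AddCircle.measurable_mk'
  rw [lintegral_withDensity_eq_lintegral_mul _ hg (by simp only [Function.comp_def]; fun_prop)]
  refine lintegral_congr fun η => ?_
  simp only [Pi.mul_apply, Function.comp_apply, enorm_mul, ENNReal.toReal_ofNat,
    ENNReal.rpow_ofNat, mul_pow]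
  rw [mul_comm]

variable {a : ℝ → ℂ} {α β : ℝ≥0∞}

theorem isFiniteMeasure_weight (ha : Measurable a) (ha2 : MemLp a 2 volume) :
    IsFiniteMeasure ((haarAddCircle : Measure (AddCircle T)).withDensity
      (fun q => ENNReal.ofReal T * periodization T (fun η => ‖a η‖ₑ ^ 2) q)) := by
  have hg : Measurable fun η => ‖a η‖ₑ ^ 2 := by fun_prop
  rw [← map_withDensity_coe hg]
  have : IsFiniteMeasure ((volume : Measure ℝ).withDensity fun η => ‖a η‖ₑ ^ 2) := by
    refine isFiniteMeasure_withDensity ?_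
    have := lintegral_rpow_enorm_lt_top_of_eLpNorm_lt_top (by norm_num) (by norm_num) ha2.2
    simpa using this.ne
  infer_instance

theorem periodization_le_of_eLpNorm_le (ha : Measurable a) (ha2 : MemLp a 2 volume) (hβ : β ≠ ∞)
    (h : ∀ p ∈ Submodule.span ℂ (range (@fourier T)),
      eLpNorm (fun η : ℝ => p η * a η) 2 volume ≤ β * eLpNorm (⇑p) 2 haarAddCircle) :
    ∀ᵐ q ∂(haarAddCircle : Measure (AddCircle T)),
      ENNReal.ofReal T * periodization T (fun η => ‖a η‖ₑ ^ 2) q ≤ β ^ 2 := by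
  have hg : Measurable fun η => ‖a η‖ₑ ^ 2 := by fun_prop
  have := isFiniteMeasure_weight (T := T) ha ha2
  refine ae_le_of_forall_setLIntegral_le_of_sigmaFinite
    ((measurable_periodization hg).const_mul _) fun E hE _ => ?_
  rw [← withDensity_apply _ hE, lintegral_const, Measure.restrict_apply_univ]
  refine measure_le_of_eLpNorm_trigPoly_le hβ (fun p hp => ?_) hE
  rw [← eLpNorm_coe_mul ha p.continuous.measurable]
  exact h p hp

theorem le_periodization_of_le_eLpNorm (ha : Measurable a) (ha2 : MemLp a 2 volume) (hα : α ≠ ∞)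
    (h : ∀ p ∈ Submodule.span ℂ (range (@fourier T)),
      eLpNorm (⇑p) 2 haarAddCircle ≤ α * eLpNorm (fun η : ℝ => p η * a η) 2 volume) :
    ∀ᵐ q ∂(haarAddCircle : Measure (AddCircle T)),
      1 ≤ α ^ 2 * (ENNReal.ofReal T * periodization T (fun η => ‖a η‖ₑ ^ 2) q) := by
  have hg : Measurable fun η => ‖a η‖ₑ ^ 2 := by fun_prop
  have hp := (measurable_periodization (T := T) hg).const_mul (ENNReal.ofReal T)
  have := isFiniteMeasure_weight (T := T) ha ha2
  refine ae_le_of_forall_setLIntegral_le_of_sigmaFinite measurable_const fun E hE _ => ?_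
  rw [lintegral_const_mul _ hp, lintegral_const, Measure.restrict_apply_univ, one_mul,
    ← withDensity_apply _ hE]
  refine measure_le_of_eLpNorm_trigPoly_le hα (fun p hp => ?_) hE
  rw [← eLpNorm_coe_mul ha p.continuous.measurable]
  exact h p hp

/-- Integration of a periodic function against `|a|²`. -/
theorem integral_coe_mul_norm_sq (ha : Measurable a)
    (hfin : ∀ᵐ q ∂(haarAddCircle : Measure (AddCircle T)),
      ENNReal.ofReal T * periodization T (fun η => ‖a η‖ₑ ^ 2) q < ∞)
    {G : AddCircle T → ℂ} (hG : Measurable G) :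
    ∫ η : ℝ, G η * (‖a η‖ ^ 2 : ℝ) = ∫ q, G q *
      ((ENNReal.ofReal T * periodization T (fun η => ‖a η‖ₑ ^ 2) q).toReal : ℂ)
        ∂(haarAddCircle : Measure (AddCircle T)) := by
  have hg : Measurable fun η => ‖a η‖ₑ ^ 2 := by fun_prop
  have hp := (measurable_periodization (T := T) hg).const_mul (ENNReal.ofReal T)
  have h1 := integral_withDensity_eq_integral_toReal_smul (μ := volume) hg
    (ae_of_all _ fun η => by simp [← enorm_pow]) (fun η : ℝ => G η)
  have h2 := integral_withDensity_eq_integral_toReal_smul hp hfin G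
  rw [← map_withDensity_coe hg, integral_map AddCircle.measurable_mk'.aemeasurable
    hG.aestronglyMeasurable, h1] at h2
  simpa [mul_comm] using h2

end Periodization

section Symbol

open AddCircle

theorem IsRieszSequence.comp_equiv {ι κ H : Type*} [NormedAddCommGroup H] [NormedSpace ℂ H]
    {v : ι → H} (hv : IsRieszSequence v) (e : κ ≃ ι) : IsRieszSequence (fun n => v (e n)) := by
  obtain ⟨A, hA, B, hB, h⟩ := hv
  refine ⟨A, hA, B, hB, fun s c => ?_⟩
  simpa using h (s.map e.toEmbedding) (fun n => c (e.symm n))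

/-- The norm of a trigonometric polynomial in terms of its coefficients. -/
theorem eLpNorm_sum_fourier {T : ℝ} [Fact (0 < T)] (s : Finset ℤ) (d : ℤ → ℂ) :
    eLpNorm (⇑(∑ n ∈ s, d n • @fourier T n)) 2 haarAddCircle
      = ENNReal.ofReal √(∑ n ∈ s, ‖d n‖ ^ 2) := by
  have h1 : ‖∑ n ∈ s, d n • @fourierLp T _ 2 _ n‖ ^ 2 = ∑ n ∈ s, ‖d n‖ ^ 2 := by
    have h := (orthonormal_fourier (T := T)).inner_sum d d s
    rw [inner_self_eq_norm_sq_to_K] at h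
    have h' : ((‖∑ n ∈ s, d n • @fourierLp T _ 2 _ n‖ ^ 2 : ℝ) : ℂ)
        = ((∑ n ∈ s, ‖d n‖ ^ 2 : ℝ) : ℂ) := by
      push_cast
      refine h.trans (Finset.sum_congr rfl fun n _ => ?_)
      rw [Complex.conj_mul']
    exact_mod_cast h'
  have h2 : ∑ n ∈ s, d n • @fourierLp T _ 2 _ n
      = ContinuousMap.toLp (E := ℂ) 2 haarAddCircle ℂ (∑ n ∈ s, d n • @fourier T n) := by
    rw [map_sum]
    simp only [map_smul]
  rw [← h1, Real.sqrt_sq (norm_nonneg _), h2, Lp.norm_def,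
    ENNReal.ofReal_toReal (Lp.eLpNorm_ne_top _)]
  exact (eLpNorm_congr_ae (ContinuousMap.coeFn_toLp _ _)).symm

variable {φ : ℝ → ℂ} (hφ : MemLp φ 2 volume) {lam : ℝ}

/-- The Fourier transform of a combination of translates is a periodic multiple of `𝓕 φ`. -/
theorem fourier_sum_translateL2 (hlam : 0 < lam) (s : Finset ℤ) (d : ℤ → ℂ) :
    (𝓕 (∑ n ∈ s, d n • translateL2 hφ (((Equiv.neg ℤ n : ℤ) : ℝ) * lam) : L2R) : L2R)
      =ᵐ[volume] fun η : ℝ => (∑ n ∈ s, d n • @fourier lam⁻¹ n) (η : AddCircle lam⁻¹) *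
        (𝓕 (hφ.toLp φ : L2R) : L2R) η := by
  have hF : (𝓕 (∑ n ∈ s, d n • translateL2 hφ (((Equiv.neg ℤ n : ℤ) : ℝ) * lam) : L2R) : L2R)
      = ∑ n ∈ s, d n • (𝓕 (translateL2 hφ (((Equiv.neg ℤ n : ℤ) : ℝ) * lam) : L2R) : L2R) := by
    change Lp.fourierTransformₗᵢ ℝ ℂ _ = ∑ n ∈ s, d n • Lp.fourierTransformₗᵢ ℝ ℂ _
    rw [map_sum]
    simp only [map_smul]
  rw [hF]
  induction s using Finset.induction_on with
  | empty =>
    filter_upwards [Lp.coeFn_zero ℂ 2 (volume : Measure ℝ)] with η h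
    simp
  | insert n s hn ih =>
    rw [Finset.sum_insert hn, Finset.sum_insert hn]
    have ih' := ih (by
      change Lp.fourierTransformₗᵢ ℝ ℂ _ = ∑ n ∈ s, d n • Lp.fourierTransformₗᵢ ℝ ℂ _
      rw [map_sum]
      simp only [map_smul])
    filter_upwards [Lp.coeFn_add
      (d n • (𝓕 (translateL2 hφ (((Equiv.neg ℤ n : ℤ) : ℝ) * lam) : L2R) : L2R))
      (∑ n ∈ s, d n • (𝓕 (translateL2 hφ (((Equiv.neg ℤ n : ℤ) : ℝ) * lam) : L2R) : L2R)),
      Lp.coeFn_smul (d n) (𝓕 (translateL2 hφ (((Equiv.neg ℤ n : ℤ) : ℝ) * lam) : L2R) : L2R),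
      fourier_translateL2 hφ (((Equiv.neg ℤ n : ℤ) : ℝ) * lam), ih'] with η h1 h2 h3 h4
    have hl : (lam : ℂ) ≠ 0 := by exact_mod_cast hlam.ne'
    have he : Complex.exp (-(2 * Real.pi * (((Equiv.neg ℤ n : ℤ) : ℝ) * lam) * η : ℝ) * Complex.I)
        = @fourier lam⁻¹ n (η : AddCircle lam⁻¹) := by
      rw [fourier_coe_apply, Equiv.neg_apply]
      congr 1
      push_cast
      field_simp
    rw [h1, Pi.add_apply, h2, Pi.smul_apply, h3, h4, he, ContinuousMap.add_apply,
      ContinuousMap.smul_apply, smul_eq_mul, smul_eq_mul]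
    ring

/-- A trigonometric polynomial times `𝓕 φ` is the Fourier transform of a combination of translates,
with norm controlled by the Riesz bounds. -/
theorem exists_span_fourier_eq (hlam : 0 < lam) [Fact (0 < lam⁻¹)] {A B : ℝ} (hA : 0 < A)
    (hAB : ∀ (s : Finset ℤ) (c : ℤ → ℂ),
      A * ∑ n ∈ s, ‖c n‖ ^ 2 ≤ ‖∑ n ∈ s, c n • translateL2 hφ ((Equiv.neg ℤ n : ℤ) * lam)‖ ^ 2 ∧
      ‖∑ n ∈ s, c n • translateL2 hφ ((Equiv.neg ℤ n : ℤ) * lam)‖ ^ 2 ≤ B * ∑ n ∈ s, ‖c n‖ ^ 2)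
    {p : C(AddCircle lam⁻¹, ℂ)}
    (hp : p ∈ Submodule.span ℂ (Set.range (@fourier lam⁻¹))) :
    (∃ y ∈ Submodule.span ℂ (Set.range fun n : ℤ => translateL2 hφ (n * lam)),
      (𝓕 (y : L2R) : L2R) =ᵐ[volume] fun η : ℝ => p η * (𝓕 (hφ.toLp φ : L2R) : L2R) η) ∧
    eLpNorm (⇑p) 2 haarAddCircle ≤ ENNReal.ofReal √A⁻¹ *
      eLpNorm (fun η : ℝ => p η * (𝓕 (hφ.toLp φ : L2R) : L2R) η) 2 volume ∧
    eLpNorm (fun η : ℝ => p η * (𝓕 (hφ.toLp φ : L2R) : L2R) η) 2 volume ≤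
      ENNReal.ofReal √B * eLpNorm (⇑p) 2 haarAddCircle := by
  obtain ⟨d, rfl⟩ := (Finsupp.mem_span_range_iff_exists_finsupp).1 hp
  rw [Finsupp.sum]
  set y : L2R := ∑ n ∈ d.support, d n • translateL2 hφ (((Equiv.neg ℤ n : ℤ) : ℝ) * lam) with hy
  have hF := fourier_sum_translateL2 hφ hlam d.support d
  have hn : eLpNorm (fun η : ℝ => (∑ n ∈ d.support, d n • @fourier lam⁻¹ n) (η : AddCircle lam⁻¹) *
      (𝓕 (hφ.toLp φ : L2R) : L2R) η) 2 volume = ENNReal.ofReal ‖y‖ := by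
    rw [← eLpNorm_congr_ae hF, ← Lp.norm_fourier_eq y, Lp.norm_def,
      ENNReal.ofReal_toReal (Lp.eLpNorm_ne_top _)]
  obtain ⟨h1, h2⟩ := hAB d.support d
  refine ⟨⟨y, Submodule.sum_mem _ fun n _ => Submodule.smul_mem _ _
    (Submodule.subset_span ⟨Equiv.neg ℤ n, rfl⟩), hF⟩, ?_, ?_⟩
  · rw [hn, eLpNorm_sum_fourier, ← ENNReal.ofReal_mul (Real.sqrt_nonneg _)]
    refine ENNReal.ofReal_le_ofReal ?_
    rw [← Real.sqrt_sq (norm_nonneg y), ← Real.sqrt_mul (by positivity)]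
    refine Real.sqrt_le_sqrt ?_
    rw [le_inv_mul_iff₀ hA]
    exact h1
  · rw [hn, eLpNorm_sum_fourier, ← ENNReal.ofReal_mul (Real.sqrt_nonneg _)]
    refine ENNReal.ofReal_le_ofReal ?_
    rw [← Real.sqrt_mul' _ (Finset.sum_nonneg fun _ _ => by positivity)]
    exact Real.le_sqrt_of_sq_le h2

/-- The symbol `λ⁻¹ ∑ₙ |𝓕φ(· + n/λ)|²` on the circle of length `λ⁻¹`. -/
def symbol (lam : ℝ) (a : ℝ → ℂ) (q : AddCircle lam⁻¹) : ℝ≥0∞ :=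
  ENNReal.ofReal lam⁻¹ * periodization lam⁻¹ (fun η => ‖a η‖ₑ ^ 2) q

theorem measurable_symbol {a : ℝ → ℂ} (ha : Measurable a) : Measurable (symbol lam a) :=
  (measurable_periodization (by fun_prop)).const_mul _

/-- The symbol of a Riesz sequence is essentially bounded above and below. -/
theorem exists_symbol_bounds (hlam : 0 < lam) [Fact (0 < lam⁻¹)]
    (hR : IsRieszSequence fun n : ℤ => translateL2 hφ (n * lam)) :
    ∃ K C : ℝ, 0 < K ∧ 0 < C ∧ ∀ᵐ q ∂(haarAddCircle : Measure (AddCircle lam⁻¹)),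
      symbol lam (𝓕 (hφ.toLp φ : L2R) : L2R) q < ∞ ∧
      K ≤ (symbol lam (𝓕 (hφ.toLp φ : L2R) : L2R) q).toReal ∧
      (symbol lam (𝓕 (hφ.toLp φ : L2R) : L2R) q).toReal ≤ C := by
  obtain ⟨A, hA, B, hB, hAB⟩ := hR.comp_equiv (Equiv.neg ℤ)
  have ha : Measurable (𝓕 (hφ.toLp φ : L2R) : L2R) := (Lp.stronglyMeasurable _).measurable
  have ha2 := Lp.memLp (𝓕 (hφ.toLp φ : L2R) : L2R)
  have h1 := periodization_le_of_eLpNorm_le ha ha2 ENNReal.ofReal_ne_top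
    fun p hp => (exists_span_fourier_eq hφ hlam hA hAB hp).2.2
  have h2 := le_periodization_of_le_eLpNorm ha ha2 ENNReal.ofReal_ne_top
    fun p hp => (exists_span_fourier_eq hφ hlam hA hAB hp).2.1
  refine ⟨A, B, hA, hB, ?_⟩
  rw [← ENNReal.ofReal_pow (Real.sqrt_nonneg _), Real.sq_sqrt hB.le] at h1
  rw [← ENNReal.ofReal_pow (Real.sqrt_nonneg _), Real.sq_sqrt (inv_pos.2 hA).le] at h2
  filter_upwards [h1, h2] with q hq1 hq2
  change symbol lam (𝓕 (hφ.toLp φ : L2R) : L2R) q ≤ _ at hq1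
  change 1 ≤ _ * symbol lam (𝓕 (hφ.toLp φ : L2R) : L2R) q at hq2
  have hfin := hq1.trans_lt ENNReal.ofReal_lt_top
  refine ⟨hfin, ?_, ENNReal.toReal_le_of_le_ofReal hB.le hq1⟩
  rw [← ENNReal.ofReal_toReal hfin.ne, ← ENNReal.ofReal_mul (inv_pos.2 hA).le,
    ENNReal.one_le_ofReal, inv_mul_eq_div, one_le_div hA] at hq2
  exact hq2

/-- Pointwise meaning of the symbol on the line. -/
theorem hasSum_of_symbol_lt_top (hlam : 0 < lam) {a : ℝ → ℂ} {η : ℝ}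
    (h : symbol lam a (η : AddCircle lam⁻¹) < ∞) :
    HasSum (fun n : ℤ => ‖a (η + n * lam⁻¹)‖ ^ 2)
      (lam * (symbol lam a (η : AddCircle lam⁻¹)).toReal) := by
  rw [symbol, periodization_coe] at h ⊢
  have hl : ENNReal.ofReal lam⁻¹ ≠ 0 := by simpa using hlam
  have hS : ∑' n : ℤ, ‖a (η + n * lam⁻¹)‖ₑ ^ 2 ≠ ∞ := fun h' => by
    rw [h', ENNReal.mul_top hl] at h
    exact h.ne rfl
  have h1 := (ENNReal.summable_toReal hS).hasSum
  rw [← ENNReal.tsum_toReal_eq fun n => by simp [← enorm_pow]] at h1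
  rw [ENNReal.toReal_mul, ENNReal.toReal_ofReal (inv_pos.2 hlam).le, mul_inv_cancel_left₀ hlam.ne']
  simpa using h1

/-- A periodic multiple of `𝓕 φ` is the transform of an element of the closed span of the
translates. -/
theorem mem_closure_span_of_fourier_eq (hlam : 0 < lam) [Fact (0 < lam⁻¹)]
    (hR : IsRieszSequence fun n : ℤ => translateL2 hφ (n * lam)) {m : AddCircle lam⁻¹ → ℂ}
    (hm : Measurable m) {u : L2R}
    (hu : (𝓕 u : L2R) =ᵐ[volume] fun η : ℝ => m η * (𝓕 (hφ.toLp φ : L2R) : L2R) η) :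
    u ∈ (Submodule.span ℂ (Set.range fun n : ℤ => translateL2 hφ (n * lam))).topologicalClosure := by
  obtain ⟨A, hA, B, hB, hAB⟩ := hR.comp_equiv (Equiv.neg ℤ)
  have ha : Measurable (𝓕 (hφ.toLp φ : L2R) : L2R) := (Lp.stronglyMeasurable _).measurable
  have ha2 := Lp.memLp (𝓕 (hφ.toLp φ : L2R) : L2R)
  have : IsFiniteMeasure ((haarAddCircle : Measure (AddCircle lam⁻¹)).withDensity
      (symbol lam (𝓕 (hφ.toLp φ : L2R) : L2R))) := isFiniteMeasure_weight ha ha2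
  have hmL : MemLp m 2 ((haarAddCircle : Measure (AddCircle lam⁻¹)).withDensity
      (symbol lam (𝓕 (hφ.toLp φ : L2R) : L2R))) := by
    refine ⟨hm.aestronglyMeasurable, ?_⟩
    have h := eLpNorm_coe_mul ha hm
    rw [← eLpNorm_congr_ae hu] at h
    exact h ▸ (Lp.memLp (𝓕 u : L2R)).2
  refine Metric.mem_closure_iff.2 fun ε hε => ?_
  obtain ⟨p, hp, hpm⟩ := exists_trigPoly_eLpNorm_sub_le _ hmL
    (ε := ENNReal.ofReal (ε / 2)) (by simpa using hε)
  obtain ⟨y, hy, hyF⟩ := (exists_span_fourier_eq hφ hlam hA hAB hp).1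
  refine ⟨y, hy, ?_⟩
  have h1 : eLpNorm (𝓕 u - 𝓕 y : L2R) 2 volume ≤ ENNReal.ofReal (ε / 2) := by
    refine le_trans (le_of_eq ?_) hpm
    refine Eq.trans ?_ (eLpNorm_coe_mul ha (hm.sub p.continuous.measurable))
    refine eLpNorm_congr_ae ?_
    filter_upwards [Lp.coeFn_sub (𝓕 u : L2R) (𝓕 y), hu, hyF] with η h1 h2 h3
    rw [h1, Pi.sub_apply, h2, h3, Pi.sub_apply, sub_mul]
  have h2 : ‖u - y‖ = ‖(𝓕 u - 𝓕 y : L2R)‖ := by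
    rw [← Lp.norm_fourier_eq (u - y)]
    congr 1
    exact (Lp.fourierTransformₗᵢ ℝ ℂ).map_sub u y
  rw [dist_eq_norm, h2, Lp.norm_def]
  exact (ENNReal.toReal_le_of_le_ofReal (by positivity) h1).trans_lt (by linarith)

end Symbol

section Dual

open AddCircle

variable {φ : ℝ → ℂ} (hφ : MemLp φ 2 volume) {lam : ℝ}

theorem fourier_translateL2_zsmul {f : ℝ → ℂ} (hf : MemLp f 2 volume) (hlam : 0 < lam) (n : ℤ) :
    (𝓕 (translateL2 hf (n * lam) : L2R) : L2R) =ᵐ[volume]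
      fun η : ℝ => @fourier lam⁻¹ (-n) (η : AddCircle lam⁻¹) * (𝓕 (hf.toLp f : L2R) : L2R) η := by
  filter_upwards [fourier_translateL2 hf (n * lam)] with η h
  rw [h, fourier_coe_apply]
  congr 2
  have hl : (lam : ℂ) ≠ 0 := by exact_mod_cast hlam.ne'
  push_cast
  field_simp

/-- The generator of the sequence dual to the integer translates of `φ`. -/
theorem exists_dual_generator (hlam : 0 < lam) [Fact (0 < lam⁻¹)]
    (hR : IsRieszSequence fun n : ℤ => translateL2 hφ (n * lam)) :
    ∃ ψ : L2R, ((𝓕 ψ : L2R) =ᵐ[volume] fun η : ℝ => (𝓕 (hφ.toLp φ : L2R) : L2R) η /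
        ((symbol lam (𝓕 (hφ.toLp φ : L2R) : L2R) (η : AddCircle lam⁻¹)).toReal : ℂ)) ∧
      (∀ n : ℤ, translateL2 (Lp.memLp ψ) (n * lam) ∈
        (Submodule.span ℂ (Set.range fun n : ℤ => translateL2 hφ (n * lam))).topologicalClosure) ∧
      ∀ n m : ℤ, (inner ℂ (translateL2 hφ (n * lam)) (translateL2 (Lp.memLp ψ) (m * lam)) : ℂ)
        = if n = m then 1 else 0 := by
  set a : ℝ → ℂ := ⇑(𝓕 (hφ.toLp φ : L2R) : L2R) with hadef
  have ha : Measurable a := (Lp.stronglyMeasurable _).measurable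
  have ha2 : MemLp a 2 volume := Lp.memLp _
  obtain ⟨K, C, hK, hC, hbd⟩ := exists_symbol_bounds hφ hlam hR
  have hs : Measurable (symbol lam a) := measurable_symbol ha
  have hm : Measurable fun q => ((symbol lam a q).toReal : ℂ)⁻¹ := by fun_prop
  have hmR : Measurable fun η : ℝ => ((symbol lam a (η : AddCircle lam⁻¹)).toReal : ℂ)⁻¹ :=
    hm.comp AddCircle.measurable_mk'
  have hG : MemLp (fun η : ℝ => a η / ((symbol lam a (η : AddCircle lam⁻¹)).toReal : ℂ)) 2
      volume := by
    refine (ha2.const_mul ((K⁻¹ : ℝ) : ℂ)).of_le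
      (by simp only [div_eq_mul_inv]; exact (ha.mul hmR).aestronglyMeasurable) ?_
    filter_upwards [ae_coe_of_ae hbd] with η h
    rw [norm_div, norm_mul, Complex.norm_real, Complex.norm_real, Real.norm_of_nonneg ENNReal.toReal_nonneg,
      Real.norm_of_nonneg (inv_pos.2 hK).le, div_eq_inv_mul]
    gcongr
    exact h.2.1
  refine ⟨𝓕⁻ (hG.toLp _ : L2R), ?_⟩
  set ψ : L2R := 𝓕⁻ (hG.toLp _ : L2R) with hψ
  have hψF : (𝓕 ψ : L2R) =ᵐ[volume]
      fun η : ℝ => a η / ((symbol lam a (η : AddCircle lam⁻¹)).toReal : ℂ) := by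
    rw [hψ, FourierTransform.fourier_fourierInv_eq]
    exact hG.coeFn_toLp
  have hτ : ∀ n : ℤ, (𝓕 (translateL2 (Lp.memLp ψ) (n * lam) : L2R) : L2R) =ᵐ[volume]
      fun η : ℝ => (@fourier lam⁻¹ (-n) (η : AddCircle lam⁻¹) *
        ((symbol lam a (η : AddCircle lam⁻¹)).toReal : ℂ)⁻¹) * a η := by
    intro n
    have h := fourier_translateL2_zsmul (Lp.memLp ψ) hlam n
    rw [Lp.toLp_coeFn] at h
    filter_upwards [h, hψF] with η h1 h2
    rw [h1, h2, div_eq_mul_inv]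
    ring
  refine ⟨hψF, fun n => ?_, fun n m => ?_⟩
  · exact mem_closure_span_of_fourier_eq hφ hlam hR
      (m := fun q => @fourier lam⁻¹ (-n) q * ((symbol lam a q).toReal : ℂ)⁻¹)
      ((@fourier lam⁻¹ (-n)).continuous.measurable.mul hm) (hτ n)
  · have h1 : (inner ℂ (translateL2 hφ (n * lam)) (translateL2 (Lp.memLp ψ) (m * lam)) : ℂ)
        = ∫ η : ℝ, (@fourier lam⁻¹ (n - m) (η : AddCircle lam⁻¹) *
          ((symbol lam a (η : AddCircle lam⁻¹)).toReal : ℂ)⁻¹) * (‖a η‖ ^ 2 : ℝ) := by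
      rw [← Lp.inner_fourier_eq, L2.inner_def]
      refine integral_congr_ae ?_
      filter_upwards [fourier_translateL2_zsmul hφ hlam n, hτ m] with η h1 h2
      rw [h1, h2, RCLike.inner_apply, map_mul, ← fourier_neg, neg_neg, ← hadef, sub_eq_add_neg,
        fourier_add]
      push_cast
      rw [← Complex.mul_conj']
      ring
    have h2 := integral_coe_mul_norm_sq (T := lam⁻¹) ha (hbd.mono fun q h => h.1)
      (G := fun q => @fourier lam⁻¹ (n - m) q * ((symbol lam a q).toReal : ℂ)⁻¹)
      ((@fourier lam⁻¹ (n - m)).continuous.measurable.mul hm)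
    rw [h1, h2]
    have h3 : ∫ q, (@fourier lam⁻¹ (n - m) q * ((symbol lam a q).toReal : ℂ)⁻¹) *
        ((symbol lam a q).toReal : ℂ) ∂haarAddCircle
        = fourierCoeff (@fourier lam⁻¹ (n - m)) 0 := by
      rw [fourierCoeff]
      refine integral_congr_ae ?_
      filter_upwards [hbd] with q hq
      have : ((symbol lam a q).toReal : ℂ) ≠ 0 := by
        exact_mod_cast (hK.trans_le hq.2.1).ne'
      simp [this]
    refine h3.trans ?_
    rw [fourierCoeff_fourier, Pi.single_apply]
    exact if_congr (by rw [eq_comm, sub_eq_zero]) rfl rfl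

end Dual

section Norm

theorem ae_comp_mul_right {P : ℝ → Prop} (h : ∀ᵐ x, P x) {c : ℝ} (hc : c ≠ 0) :
    ∀ᵐ x, P (x * c) := by
  refine ae_of_ae_map (f := fun x => x * c) (by fun_prop) ?_
  rw [Real.map_volume_mul_right hc]
  exact Measure.ae_smul_measure h _

theorem ae_comp_div_two_pi {P : ℝ → Prop} (h : ∀ᵐ x, P x) : ∀ᵐ x, P (x / (2 * Real.pi)) := by
  simpa only [div_eq_mul_inv] using
    ae_comp_mul_right h (c := (2 * Real.pi)⁻¹) (inv_ne_zero Real.two_pi_pos.ne')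

theorem fourierL2_apply {f : ℝ → ℂ} (hf : MemLp f 2 volume) (ξ : ℝ) :
    fourierL2 f ξ = ((√(2 * Real.pi))⁻¹ : ℂ) * (𝓕 (hf.toLp f : L2R) : L2R) (ξ / (2 * Real.pi)) := by
  rw [fourierL2, dif_pos hf]

theorem inv_sqrt_two_pi_ne_zero : ((√(2 * Real.pi))⁻¹ : ℂ) ≠ 0 := by
  have : √(2 * Real.pi) ≠ 0 := (Real.sqrt_pos.2 Real.two_pi_pos).ne'
  exact inv_ne_zero (by exact_mod_cast this)

/-- Square integrable functions with the same transform agree almost everywhere. -/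
theorem ae_eq_of_fourierL2_ae_eq {f g : ℝ → ℂ} (hf : MemLp f 2 volume) (hg : MemLp g 2 volume)
    (h : fourierL2 f =ᵐ[volume] fourierL2 g) : f =ᵐ[volume] g := by
  have h1 : (𝓕 (hf.toLp f : L2R) : L2R) = 𝓕 (hg.toLp g : L2R) := by
    refine Lp.ext ?_
    filter_upwards [ae_comp_mul_right h Real.two_pi_pos.ne'] with η hη
    rw [fourierL2_apply hf, fourierL2_apply hg, mul_div_cancel_right₀ _ Real.two_pi_pos.ne'] at hη
    exact mul_left_cancel₀ inv_sqrt_two_pi_ne_zero hη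
  have h2 : hf.toLp f = hg.toLp g := (Lp.fourierTransformₗᵢ ℝ ℂ).injective h1
  exact (MemLp.toLp_eq_toLp_iff hf hg).1 h2

variable {φ : ℝ → ℂ} (hφ : MemLp φ 2 volume)

/-- The transform of `P_φ f`. -/
theorem fourierL2_prefilter_ae {f : ℝ → ℂ} (hf : MemLp f 2 volume) {C : ℝ}
    (hb : ∀ᵐ η : ℝ, ‖(𝓕 (hφ.toLp φ : L2R) : L2R) η‖ ≤ C) :
    ∀ᵐ ξ : ℝ, fourierL2 (prefilter φ f) ξ = ((√(2 * Real.pi))⁻¹ : ℂ) *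
      ((𝓕 (hf.toLp f : L2R) : L2R) (ξ / (2 * Real.pi)) *
        conj ((𝓕 (hφ.toLp φ : L2R) : L2R) (ξ / (2 * Real.pi)))) := by
  have h := memLp_prefilter hφ hf hb
  filter_upwards [ae_comp_div_two_pi (fourier_prefilter hφ hf hb h)] with ξ hξ
  rw [fourierL2_apply h, hξ]

/-- The `𝒫_φ`-norm of `P_φ u` is the `L²`-norm of the part of `u` with frequencies in the
support of `𝓕 φ`. -/
theorem normP_prefilter {C : ℝ} (hb : ∀ᵐ η : ℝ, ‖(𝓕 (hφ.toLp φ : L2R) : L2R) η‖ ≤ C) {u v : L2R}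
    (hv : (𝓕 v : L2R) =ᵐ[volume]
      (Function.support (𝓕 (hφ.toLp φ : L2R) : L2R)).indicator (𝓕 u : L2R)) :
    normP φ (prefilter φ u) = ‖v‖ := by
  set a : ℝ → ℂ := ⇑(𝓕 (hφ.toLp φ : L2R) : L2R) with hadef
  have ha : Measurable a := (Lp.stronglyMeasurable _).measurable
  have hk := inv_sqrt_two_pi_ne_zero
  have hsupp : Function.support (fourierL2 φ) = {ξ | a (ξ / (2 * Real.pi)) ≠ 0} := by
    ext ξ
    rw [Function.mem_support, fourierL2_apply hφ]
    simp only [ne_eq, mul_eq_zero, hk, false_or]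
    rfl
  have hmeas : MeasurableSet {ξ : ℝ | a (ξ / (2 * Real.pi)) ≠ 0} :=
    (measurableSet_singleton (0 : ℂ)).compl.preimage (ha.comp (measurable_id.div_const _))
  have hint : ∫ ξ in Function.support (fourierL2 φ), fourierL2 (prefilter φ u) ξ *
      conj (fourierL2 (prefilter φ u) ξ) * ((‖fourierL2 φ ξ‖ ^ 2 : ℝ) : ℂ)⁻¹
      = ∫ ξ : ℝ, (fun η => ((‖(𝓕 v : L2R) η‖ ^ 2 : ℝ) : ℂ)) (ξ / (2 * Real.pi)) := by
    rw [hsupp, ← integral_indicator hmeas]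
    have hp := fourierL2_prefilter_ae hφ (Lp.memLp u) hb
    rw [Lp.toLp_coeFn] at hp
    refine integral_congr_ae ?_
    filter_upwards [hp, ae_comp_div_two_pi hv] with ξ h1 h2
    by_cases hξ : a (ξ / (2 * Real.pi)) = 0
    · rw [Set.indicator_of_notMem (by simpa using hξ), h2,
        Set.indicator_of_notMem (by simpa using hξ)]
      simp
    · rw [Set.indicator_of_mem (by simpa using hξ), h1, h2,
        Set.indicator_of_mem (by simpa using hξ), fourierL2_apply hφ, ← hadef]
      push_cast
      rw [← Complex.mul_conj', ← Complex.mul_conj']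
      simp only [map_mul, Complex.conj_conj]
      have h3 : conj (a (ξ / (2 * Real.pi))) ≠ 0 := by simpa using hξ
      have h4 : conj ((√(2 * Real.pi))⁻¹ : ℂ) ≠ 0 := by simpa using hk
      field_simp
  have hinner : innerP φ (prefilter φ u) (prefilter φ u) = ((‖v‖ ^ 2 : ℝ) : ℂ) := by
    have hscale := Measure.integral_comp_div (fun η => ((‖(𝓕 v : L2R) η‖ ^ 2 : ℝ) : ℂ))
      (2 * Real.pi)
    rw [innerP, hint, hscale, abs_of_pos Real.two_pi_pos, Complex.real_smul,
      inv_mul_cancel_left₀ (by exact_mod_cast Real.two_pi_pos.ne')]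
    have h1 : (inner ℂ (𝓕 v : L2R) (𝓕 v : L2R) : ℂ) = (‖v‖ : ℂ) ^ 2 := by
      rw [inner_self_eq_norm_sq_to_K, Lp.norm_fourier_eq]
      rfl
    rw [Complex.ofReal_pow, ← h1, L2.inner_def]
    refine integral_congr_ae (ae_of_all _ fun η => ?_)
    simp only [RCLike.inner_apply]
    rw [Complex.mul_conj']
    push_cast
    rfl
  rw [normP, hinner, Complex.ofReal_re, Real.sqrt_sq (norm_nonneg _)]

/-- The frequency cutoff to the support of `𝓕 φ`. -/
theorem exists_cutoff (u : L2R) : ∃ v : L2R, ((𝓕 v : L2R) =ᵐ[volume]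
      (Function.support (𝓕 (hφ.toLp φ : L2R) : L2R)).indicator (𝓕 u : L2R)) ∧ ‖v‖ ≤ ‖u‖ := by
  have ha : Measurable (𝓕 (hφ.toLp φ : L2R) : L2R) := (Lp.stronglyMeasurable _).measurable
  have hS : MeasurableSet (Function.support (𝓕 (hφ.toLp φ : L2R) : L2R)) :=
    measurableSet_support ha
  have hI := (Lp.memLp (𝓕 u : L2R)).indicator hS
  refine ⟨𝓕⁻ (hI.toLp _ : L2R), ?_, ?_⟩
  · rw [FourierTransform.fourier_fourierInv_eq]
    exact hI.coeFn_toLp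
  · rw [← Lp.norm_fourier_eq, FourierTransform.fourier_fourierInv_eq, ← Lp.norm_fourier_eq u,
      Lp.norm_toLp, Lp.norm_def]
    exact ENNReal.toReal_mono (Lp.eLpNorm_ne_top _) (eLpNorm_indicator_le _)

theorem normP_prefilter_le {C : ℝ} (hb : ∀ᵐ η : ℝ, ‖(𝓕 (hφ.toLp φ : L2R) : L2R) η‖ ≤ C) (u : L2R) :
    normP φ (prefilter φ u) ≤ ‖u‖ := by
  obtain ⟨v, hv, hle⟩ := exists_cutoff hφ u
  rwa [normP_prefilter hφ hb hv]

theorem prefilter_cutoff {u v : L2R} (hv : (𝓕 v : L2R) =ᵐ[volume]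
      (Function.support (𝓕 (hφ.toLp φ : L2R) : L2R)).indicator (𝓕 u : L2R)) :
    prefilter φ v = prefilter φ u := by
  rw [prefilter_eq_fourierInv hφ (Lp.memLp v), prefilter_eq_fourierInv hφ (Lp.memLp u),
    Lp.toLp_coeFn, Lp.toLp_coeFn]
  funext x
  refine Real.fourierInv_congr_ae ?_ x
  filter_upwards [hv] with η h
  rw [h]
  by_cases hη : (𝓕 (hφ.toLp φ : L2R) : L2R) η = 0
  · simp [hη]
  · rw [Set.indicator_of_mem (by simpa using hη)]

end Norm

section Reconstruction

open AddCircle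

variable {φ : ℝ → ℂ} (hφ : MemLp φ 2 volume) {lam : ℝ}

theorem prefilter_translate (f : ℝ → ℂ) (t : ℝ) :
    prefilter φ (translate t f) = translate t (prefilter φ f) := by
  funext x
  rw [translate, prefilter, prefilter,
    ← integral_sub_right_eq_self (fun y => f y * conj (φ (y - (x - t)))) t]
  refine integral_congr_ae (ae_of_all _ fun y => ?_)
  simp only [translate]
  congr 3
  ring

/-- The prefilter as a linear map on `L²(ℝ)`. -/
def prefilterₗ : L2R →ₗ[ℂ] (ℝ → ℂ) :=
  LinearMap.pi fun x => (innerSL ℂ (translateL2 hφ x)).toLinearMap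

theorem prefilterₗ_apply (u : L2R) : prefilterₗ hφ u = prefilter φ u := by
  funext x
  rw [prefilter_eq_inner hφ (Lp.memLp u), Lp.toLp_coeFn]
  rfl

theorem prefilterₗ_toLp {f : ℝ → ℂ} (hf : MemLp f 2 volume) :
    prefilterₗ hφ (hf.toLp f) = prefilter φ f := by
  rw [prefilterₗ_apply, prefilter_congr_ae hf.coeFn_toLp]

theorem prefilterₗ_translateL2 {f : ℝ → ℂ} (hf : MemLp f 2 volume) (t : ℝ) :
    prefilterₗ hφ (translateL2 hf t) = translate t (prefilter φ f) := by
  rw [translateL2, prefilterₗ_toLp, prefilter_translate]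

theorem norm_prefilterₗ_le (u : L2R) (x : ℝ) : ‖prefilterₗ hφ u x‖ ≤ ‖hφ.toLp φ‖ * ‖u‖ := by
  rw [prefilterₗ_apply]
  simpa only [Lp.toLp_coeFn] using norm_prefilter_le hφ (Lp.memLp u) x

theorem map_prefilterₗ_span (lam : ℝ) :
    (Submodule.span ℂ (Set.range fun n : ℤ => translateL2 hφ (n * lam))).map (prefilterₗ hφ)
      = Submodule.span ℂ (Set.range fun n : ℤ => translate (n * lam) (autocorr φ)) := by
  rw [Submodule.map_span, ← Set.range_comp]
  simp only [Function.comp_def, prefilterₗ_translateL2, autocorr]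

theorem exists_fourier_bound (hlam : 0 < lam) [Fact (0 < lam⁻¹)]
    (hR : IsRieszSequence fun n : ℤ => translateL2 hφ (n * lam)) :
    ∃ C : ℝ, ∀ᵐ η : ℝ, ‖(𝓕 (hφ.toLp φ : L2R) : L2R) η‖ ≤ C := by
  obtain ⟨K, C, hK, hC, hbd⟩ := exists_symbol_bounds hφ hlam hR
  refine ⟨√(lam * C), ?_⟩
  filter_upwards [ae_coe_of_ae hbd] with η h
  refine Real.le_sqrt_of_sq_le ?_
  have h1 := le_hasSum (hasSum_of_symbol_lt_top hlam h.1) 0 fun _ _ => by positivity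
  simp only [Int.cast_zero, zero_mul, add_zero] at h1
  exact h1.trans (by gcongr; exact h.2.2)

theorem fourier_eq_zero_of_mem_span {y : L2R}
    (hy : y ∈ Submodule.span ℂ (Set.range fun n : ℤ => translateL2 hφ (n * lam))) :
    ∀ᵐ η : ℝ, (𝓕 (hφ.toLp φ : L2R) : L2R) η = 0 → (𝓕 y : L2R) η = 0 := by
  induction hy using Submodule.span_induction with
  | mem y hy =>
    obtain ⟨n, rfl⟩ := hy
    filter_upwards [fourier_translateL2 hφ (n * lam)] with η h h0
    rw [h, h0, mul_zero]
  | zero =>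
    have h0 : (𝓕 (0 : L2R) : L2R) = 0 := (Lp.fourierTransformₗᵢ ℝ ℂ).map_zero
    rw [h0]
    filter_upwards [Lp.coeFn_zero ℂ 2 (volume : Measure ℝ)] with η h _
    rw [h]; rfl
  | add x y _ _ hx hy =>
    have h0 : (𝓕 (x + y : L2R) : L2R) = 𝓕 x + 𝓕 y := (Lp.fourierTransformₗᵢ ℝ ℂ).map_add x y
    rw [h0]
    filter_upwards [Lp.coeFn_add (𝓕 x : L2R) (𝓕 y), hx, hy] with η h h1 h2 h3
    rw [h, Pi.add_apply, h1 h3, h2 h3, add_zero]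
  | smul c x _ hx =>
    have h0 : (𝓕 (c • x : L2R) : L2R) = c • 𝓕 x := (Lp.fourierTransformₗᵢ ℝ ℂ).map_smul c x
    rw [h0]
    filter_upwards [Lp.coeFn_smul c (𝓕 x : L2R), hx] with η h h1 h3
    rw [h, Pi.smul_apply, h1 h3, smul_zero]

/-- The prefilter maps the closed span of the translates of `φ` into the reconstruction space. -/
theorem prefilterₗ_mem_reconstructionSpace {C : ℝ}
    (hb : ∀ᵐ η : ℝ, ‖(𝓕 (hφ.toLp φ : L2R) : L2R) η‖ ≤ C) {u : L2R} (hu : u ∈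
      (Submodule.span ℂ (Set.range fun n : ℤ => translateL2 hφ (n * lam))).topologicalClosure) :
    prefilterₗ hφ u ∈ reconstructionSpace φ lam := by
  refine ⟨⟨u, Lp.memLp u, prefilterₗ_apply hφ u⟩, fun ε hε => ?_⟩
  obtain ⟨y, hy, hyu⟩ := Metric.mem_closure_iff.1 hu ε hε
  refine ⟨prefilterₗ hφ y, ?_, ?_⟩
  · rw [← map_prefilterₗ_span hφ]
    exact Submodule.mem_map_of_mem hy
  · rw [← map_sub, prefilterₗ_apply]
    exact (normP_prefilter_le hφ hb _).trans_lt (by rwa [← dist_eq_norm])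

/-- Every element of the reconstruction space is the prefilter of an element of the closed span of
the translates of `φ`. -/
theorem exists_of_mem_reconstructionSpace {C : ℝ}
    (hb : ∀ᵐ η : ℝ, ‖(𝓕 (hφ.toLp φ : L2R) : L2R) η‖ ≤ C) {g : ℝ → ℂ}
    (hg : g ∈ reconstructionSpace φ lam) :
    ∃ v ∈ (Submodule.span ℂ
        (Set.range fun n : ℤ => translateL2 hφ (n * lam))).topologicalClosure,
      g = prefilterₗ hφ v := by
  obtain ⟨⟨f, hf, rfl⟩, happ⟩ := hg
  obtain ⟨v, hv, -⟩ := exists_cutoff hφ (hf.toLp f)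
  have hpv : prefilterₗ hφ v = prefilter φ f := by
    rw [prefilterₗ_apply, prefilter_cutoff hφ hv, prefilter_congr_ae hf.coeFn_toLp]
  refine ⟨v, Metric.mem_closure_iff.2 fun ε hε => ?_, hpv.symm⟩
  obtain ⟨w, hw, hlt⟩ := happ ε hε
  rw [← map_prefilterₗ_span hφ] at hw
  obtain ⟨y, hy, rfl⟩ := hw
  refine ⟨y, hy, ?_⟩
  rw [← hpv, ← map_sub, prefilterₗ_apply, normP_prefilter hφ hb (v := v - y)] at hlt
  · rwa [dist_eq_norm]
  · have h0 : (𝓕 (v - y : L2R) : L2R) = 𝓕 v - 𝓕 y := (Lp.fourierTransformₗᵢ ℝ ℂ).map_sub v y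
    rw [h0]
    filter_upwards [Lp.coeFn_sub (𝓕 v : L2R) (𝓕 y), hv, fourier_eq_zero_of_mem_span hφ hy]
      with η h1 h2 h3
    by_cases hη : (𝓕 (hφ.toLp φ : L2R) : L2R) η = 0
    · rw [Set.indicator_of_notMem (by simpa using hη)] at h2 ⊢
      rw [h1, Pi.sub_apply, h2, h3 hη, sub_zero]
    · rw [Set.indicator_of_mem (by simpa using hη)]

/-- The prefilter of the dual generator has the interpolating transform. -/
theorem hasInterpolatingTransform_prefilter (hlam : 0 < lam) [Fact (0 < lam⁻¹)]
    (hR : IsRieszSequence fun n : ℤ => translateL2 hφ (n * lam)) {ψ : L2R}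
    (hψ : (𝓕 ψ : L2R) =ᵐ[volume] fun η : ℝ => (𝓕 (hφ.toLp φ : L2R) : L2R) η /
        ((symbol lam (𝓕 (hφ.toLp φ : L2R) : L2R) (η : AddCircle lam⁻¹)).toReal : ℂ)) :
    HasInterpolatingTransform φ lam (prefilter φ ψ) := by
  set a : ℝ → ℂ := ⇑(𝓕 (hφ.toLp φ : L2R) : L2R) with hadef
  obtain ⟨K, C, hK, hC, hbd⟩ := exists_symbol_bounds hφ hlam hR
  obtain ⟨D, hb⟩ := exists_fourier_bound hφ hlam hR
  refine ⟨memLp_prefilter hφ (Lp.memLp ψ) hb, ?_⟩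
  have hΦ := fourierL2_prefilter_ae hφ hφ hb
  have hΦall : ∀ᵐ ξ : ℝ, ∀ n : ℤ, fourierL2 (autocorr φ) (ξ + n * (2 * Real.pi / lam))
      = ((√(2 * Real.pi))⁻¹ : ℂ) *
        ((‖a (ξ / (2 * Real.pi) + n * lam⁻¹)‖ ^ 2 : ℝ) : ℂ) := by
    refine ae_all_iff.2 fun n => ?_
    filter_upwards [(measurePreserving_add_right (volume : Measure ℝ)
      (n * (2 * Real.pi / lam))).quasiMeasurePreserving.ae hΦ] with ξ h
    have harg : (ξ + n * (2 * Real.pi / lam)) / (2 * Real.pi)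
        = ξ / (2 * Real.pi) + n * lam⁻¹ := by
      have := Real.pi_pos.ne'
      field_simp
    rw [autocorr, h, harg, ← hadef, Complex.mul_conj']
    push_cast
    rfl
  have hint := fourierL2_prefilter_ae hφ (Lp.memLp ψ) hb
  rw [Lp.toLp_coeFn] at hint
  filter_upwards [hΦall, hint, ae_comp_div_two_pi hψ, ae_comp_div_two_pi (ae_coe_of_ae hbd)]
    with ξ h1 h2 h3 h4
  set η := ξ / (2 * Real.pi)
  set σ : ℝ := (symbol lam a (η : AddCircle lam⁻¹)).toReal with hσ
  have hσ0 : (σ : ℂ) ≠ 0 := by exact_mod_cast (hK.trans_le h4.2.1).ne'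
  have hsum := hasSum_of_symbol_lt_top hlam h4.1
  rw [← hσ] at hsum
  have hsumC : HasSum (fun n : ℤ => fourierL2 (autocorr φ) (ξ + n * (2 * Real.pi / lam)))
      (((√(2 * Real.pi))⁻¹ : ℂ) * ((lam * σ : ℝ) : ℂ)) := by
    simp only [h1]
    exact (Complex.hasSum_ofReal.2 hsum).mul_left _
  have hden : intDenominator φ lam ξ = σ := by
    rw [intDenominator, hsumC.tsum_eq]
    have hl : lam ≠ 0 := hlam.ne'
    have hs : √(2 * Real.pi) ≠ 0 := (Real.sqrt_pos.2 Real.two_pi_pos).ne'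
    have hss : √(2 * Real.pi) ^ 2 = 2 * Real.pi := Real.sq_sqrt Real.two_pi_pos.le
    rw [← Complex.ofReal_inv, ← Complex.ofReal_mul, ← Complex.ofReal_mul]
    congr 1
    field_simp
    rw [hss]
  refine ⟨hsumC.summable, hden ▸ hσ0, ?_⟩
  have h0 := h1 0
  simp only [Int.cast_zero, zero_mul, add_zero] at h0
  rw [hden, h0, h2, h3, Complex.ofReal_pow, ← Complex.mul_conj']
  ring

/-- The reconstruction series of an element of the closed span, transported by the prefilter. -/
theorem tendstoUniformly_prefilterₗ {F : ℤ → L2R} {v : L2R} (h : HasSum F v) :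
    TendstoUniformly (fun (s : Finset ℤ) (x : ℝ) => ∑ n ∈ s, prefilterₗ hφ (F n) x)
      (prefilterₗ hφ v) atTop := by
  rw [Metric.tendstoUniformly_iff]
  intro ε hε
  have hpos : 0 < ‖hφ.toLp φ‖ + 1 := by positivity
  filter_upwards [Metric.tendsto_nhds.1 h (ε / (‖hφ.toLp φ‖ + 1)) (by positivity)] with s hs x
  have h1 : prefilterₗ hφ v x - ∑ n ∈ s, prefilterₗ hφ (F n) x
      = prefilterₗ hφ (v - ∑ n ∈ s, F n) x := by
    rw [map_sub, map_sum, Pi.sub_apply, Finset.sum_apply]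
  rw [dist_eq_norm, h1]
  rw [dist_comm, dist_eq_norm, lt_div_iff₀ hpos] at hs
  refine (norm_prefilterₗ_le hφ _ x).trans_lt (lt_of_le_of_lt ?_ hs)
  rw [mul_comm]
  gcongr
  linarith

end Reconstruction

end FreqLoc

end

theorem theorem1 (φ : ℝ → ℂ) (w : ℝ → ℝ) (Lset : Set ℝ)
    (hφ : MemLp φ 2 volume)
    (hw : FreqLoc.IsWeight w)
    (hmom : FreqLoc.HasFiniteMoment w φ)
    (hLne : Lset.Nonempty)
    (hLpos : ∀ l ∈ Lset, 0 < l)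
    (hRiesz : ∀ l ∈ Lset,
      FreqLoc.IsRieszSequence (fun n : ℤ => FreqLoc.translateL2 hφ (n * l)))
    (lam : ℝ) (hlam : lam ∈ Lset) :
    ∃ Φint ∈ FreqLoc.reconstructionSpace φ lam,
      FreqLoc.HasInterpolatingTransform φ lam Φint ∧
      (∀ h ∈ FreqLoc.localizationSpace φ,
        FreqLoc.HasInterpolatingTransform φ lam h → h = Φint) ∧
      ∀ g ∈ FreqLoc.reconstructionSpace φ lam,
        (∀ x : ℝ, HasSum (fun n : ℤ => g (n * lam) * Φint (x - n * lam)) (g x)) ∧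
        Tendsto (fun s : Finset ℤ => FreqLoc.normP φ
            (g - ∑ n ∈ s, g (n * lam) • FreqLoc.translate (n * lam) Φint))
          atTop (𝓝 0) ∧
        TendstoUniformly
          (fun (s : Finset ℤ) (x : ℝ) => ∑ n ∈ s, g (n * lam) * Φint (x - n * lam))
          g atTop := by
  have hl : 0 < lam := hLpos lam hlam
  have hR := hRiesz lam hlam
  have : Fact (0 < lam⁻¹) := ⟨inv_pos.2 hl⟩
  obtain ⟨C, hb⟩ := FreqLoc.exists_fourier_bound hφ hl hR
  obtain ⟨ψ, hψ, hψV, hbi⟩ := FreqLoc.exists_dual_generator hφ hl hR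
  have hΦ := FreqLoc.hasInterpolatingTransform_prefilter hφ hl hR hψ
  refine ⟨FreqLoc.prefilter φ ψ, ?_, hΦ, ?_, ?_⟩
  · have h0 : FreqLoc.translateL2 (Lp.memLp ψ) (((0 : ℤ) : ℝ) * lam) = ψ := by
      refine Lp.ext ((FreqLoc.memLp_translate (Lp.memLp ψ) _).coeFn_toLp.trans ?_)
      refine ae_of_all _ fun x => ?_
      simp [FreqLoc.translate]
    rw [← FreqLoc.prefilterₗ_apply hφ]
    exact FreqLoc.prefilterₗ_mem_reconstructionSpace hφ hb (h0 ▸ hψV 0)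
  · rintro h ⟨f, hf, rfl⟩ hh
    refine Continuous.ae_eq_iff_eq volume (FreqLoc.continuous_prefilter hφ hf)
      (FreqLoc.continuous_prefilter hφ (Lp.memLp ψ)) |>.1 ?_
    refine FreqLoc.ae_eq_of_fourierL2_ae_eq hh.1 hΦ.1 ?_
    filter_upwards [hh.2, hΦ.2] with ξ h1 h2
    rw [h1.2.2, h2.2.2]
  · intro g hg
    obtain ⟨v, hv, rfl⟩ := FreqLoc.exists_of_mem_reconstructionSpace hφ hb hg
    have hsum := hR.hasSum_dual (w := fun n : ℤ => FreqLoc.translateL2 (Lp.memLp ψ) (n * lam))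
      (fun n => by rw [hbi, if_pos rfl]) (fun m n hmn => by rw [hbi, if_neg hmn]) hψV hv
    have hterm : ∀ n : ℤ, FreqLoc.prefilterₗ hφ ((inner ℂ (FreqLoc.translateL2 hφ (n * lam)) v : ℂ) •
        FreqLoc.translateL2 (Lp.memLp ψ) (n * lam)) = FreqLoc.prefilterₗ hφ v (n * lam) •
          FreqLoc.translate (n * lam) (FreqLoc.prefilter φ ψ) := by
      intro n
      rw [map_smul, FreqLoc.prefilterₗ_translateL2]
      rfl
    have hunif := FreqLoc.tendstoUniformly_prefilterₗ hφ hsum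
    simp only [hterm] at hunif
    refine ⟨fun x => hunif.tendsto_at x, ?_, hunif⟩
    have hdiff : ∀ s : Finset ℤ, FreqLoc.prefilterₗ hφ v - ∑ n ∈ s,
        FreqLoc.prefilterₗ hφ v (n * lam) • FreqLoc.translate (n * lam) (FreqLoc.prefilter φ ψ)
        = FreqLoc.prefilter φ (v - ∑ n ∈ s, (inner ℂ (FreqLoc.translateL2 hφ (n * lam)) v : ℂ) •
          FreqLoc.translateL2 (Lp.memLp ψ) (n * lam) : FreqLoc.L2R) := by
      intro s
      refine Eq.trans ?_ (FreqLoc.prefilterₗ_apply hφ _)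
      rw [map_sub, map_sum]
      simp only [hterm]
    simp only [hdiff]
    have hlim := (tendsto_const_nhds (x := v)).sub hsum |>.norm
    rw [sub_self, norm_zero] at hlim
    exact squeeze_zero (fun s => Real.sqrt_nonneg _)
      (fun s => FreqLoc.normP_prefilter_le hφ hb _) hlim
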